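/- For a meromorphic function $g$ on $\mathbb{C}$ let $T(r,g)$ be its Nevanlinna characteristic, let $N(r,0;g)$ and $\overline N(r,0;g)$ be the (integrated) counting functions of the zeros of $g$ counted with, respectively without, multiplicity, let $\overline N(r,\infty;g)$ be the counting function of the poles of $g$ counted without multiplicity, and for a meromorphic function $\varphi$ put $\overline N(r,\varphi;g)=\overline N(r,0;g-\varphi)$. For a non-constant meromorphic function $f$ on $\mathbb{C}$, $S(r,f)$ denotes any quantity with $S(r,f)=o(T(r,f))$ as $r\to\infty$, $r\notin E$, for some set $E\subset(0,\infty)$ of finite linear measure. A meromorphic function $b\not\equiv 0,\infty$ on $\mathbb{C}$ is a small function of $f$ if $T(r,b)=S(r,f)$. **Theorem 2.1.** Let $f$ be a transcendental (that is, non-rational) meromorphic function on $\mathbb{C}$, and let $a,\varphi\ (\not\equiv 0,\infty)$ be small functions of $f$. Let $k\ge 1$ and let $q_0,\dots,q_k\ge 0$ be integers with $q_0\ge 1$ and $q_k\ge 1$. Put $$M[f]=a\,f^{q_0}(f')^{q_1}\cdots(f^{(k)})^{q_k},\qquad \mu=q_0+q_1+\cdots+q_k,\qquad \mu_*=q_1+2q_2+\cdots+kq_k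 .$$ Then $$\mu\,T(r,f)\le \overline N(r,\infty;f)+(\mu-q_0)\,N(r,0;f)+(1+\mu_*)\,\overline N(r,0;f)+\overline N(r,\varphi;M[f])+S(r,f).$$ -/

import Mathlib

open Filter MeasureTheory Set Function MeromorphicOn ValueDistribution
open scoped Topology Polynomial

noncomputable section

namespace Nevanlinna

/-- A transcendental meromorphic function on the plane: a meromorphic function that is not (the
function given by) a quotient of two polynomials. Meromorphic functions are identified when they
agree off a closed discrete set, so their values at poles play no role. -/
def IsTranscendentalMeromorphic (f : ℂ → ℂ) : Prop :=
  Meromorphic f ∧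
    ¬ ∃ P Q : ℂ[X], Q ≠ 0 ∧ f =ᶠ[codiscrete ℂ] fun z ↦ P.eval z / Q.eval z

/-- `S` is an error term `S(r, f)`, i.e. `S(r) = o(T(r, f))` as `r → ∞` outside some set `E` of
positive reals of finite linear measure. Here `T(r, f)` is `characteristic f ⊤ r`. -/
def IsErrorTerm (f : ℂ → ℂ) (S : ℝ → ℝ) : Prop :=
  ∃ E : Set ℝ, E ⊆ Ioi 0 ∧ volume E < ⊤ ∧
    S =o[atTop ⊓ 𝓟 Eᶜ] (characteristic f ⊤)

/-- `b` is a small function of `f`: a meromorphic function, not identically zero, with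
`T(r, b) = S(r, f)`. -/
def IsSmallFunction (f b : ℂ → ℂ) : Prop :=
  Meromorphic b ∧ ¬ b =ᶠ[codiscrete ℂ] (fun _ ↦ 0) ∧ IsErrorTerm f (characteristic b ⊤)

/-- The reduction of a divisor: every point of positive multiplicity gets multiplicity one, and
every other point gets multiplicity zero. -/
def reducedDivisor (D : locallyFinsupp ℂ ℤ) : locallyFinsupp ℂ ℤ where
  toFun z := if 0 < D z then 1 else 0
  supportWithinDomain' := subset_univ _
  supportLocallyFiniteWithinDomain' z hz := by
    obtain ⟨t, ht, hfin⟩ := D.supportLocallyFiniteWithinDomain' z hz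
    refine ⟨t, ht, hfin.subset ?_⟩
    rintro w ⟨hwt, hw⟩
    refine ⟨hwt, fun h0 ↦ hw ?_⟩
    have h0' : D w = 0 := h0
    simp [h0']

/-- The reduced counting function `N̄(r, 0; f)`: zeros counted without multiplicity. -/
def reducedCountingZeros (f : ℂ → ℂ) : ℝ → ℝ :=
  (reducedDivisor (divisor f univ)⁺).logCounting

/-- The reduced counting function `N̄(r, ∞; f)`: poles counted without multiplicity. -/
def reducedCountingPoles (f : ℂ → ℂ) : ℝ → ℝ :=
  (reducedDivisor (divisor f univ)⁻).logCounting

/-- The differential monomial `M[f] = a f ^ q₀ (f') ^ q₁ ⋯ (f⁽ᵏ⁾) ^ qₖ`. -/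
def diffMonomial (a : ℂ → ℂ) (k : ℕ) (q : ℕ → ℕ) (f : ℂ → ℂ) : ℂ → ℂ :=
  fun z ↦ a z * ∏ i ∈ Finset.range (k + 1), (iteratedDeriv i f z) ^ q i

/-- The degree `q₀ + q₁ + ⋯ + qₖ`. -/
def monomialDegree (k : ℕ) (q : ℕ → ℕ) : ℕ := ∑ i ∈ Finset.range (k + 1), q i

/-- The weight `q₁ + 2 q₂ + ⋯ + k qₖ`. -/
def monomialWeight (k : ℕ) (q : ℕ → ℕ) : ℕ := ∑ i ∈ Finset.range (k + 1), i * q i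

end Nevanlinna

end

/-!
The proof applies the argument behind the second main theorem to the value `1` of
`F = M[f] / φ = b M₀`, where `b = a / φ` and `M₀ = ∏ (f⁽ⁱ⁾) ^ qᵢ` has degree `μ`.

Writing each `f⁽ⁱ⁾` as `f` times logarithmic derivatives of the lower derivatives gives
`F = W f ^ μ`, where `W` is `b` times a product of logarithmic derivatives. With
`L = (F - 1)' / (F - 1)` the identity `f ^ (-μ) = W (1 - (F' / F) L⁻¹)` holds, and the lemma on the
logarithmic derivative yields `μ m(r, 1/f) ≤ m(r, L⁻¹) + S(r, f)`
(`exists_proximity_inv_add_logCounting_le`). Jensen's formula trades `m(r, L⁻¹)` for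
`m(r, L) - N(r, div L) + O(1)`, and `m(r, L) = S(r, f)` again. The first main theorem then gives
`μ T(r, f) ≤ μ N(r, 0; f) - N(r, div L) + S(r, f)`, and it remains to compare divisors pointwise
(`nsmul_divisor_sub_le`): `q₀ (div f)⁺ - div L` is at most the sum of the reduced divisors of the
poles of `f`, of the zeros of `f` and of the zeros of `M[f] - φ`, up to the zeros and poles of `a`
and `φ`. The reason is that `L` has a pole of order one at each pole of `F` and at each zero of
`F - 1`, while a zero of `F` of order `n` makes `L` vanish to order `n - 1`, and `n ≥ q₀ p` at a
zero of `f` of order `p` at which `a` and `φ` are regular and nonzero. If `F` is constant, `L` is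
unavailable, but then `f ^ (-μ)` is a constant multiple of `W` and `f` has few zeros. This proves
the estimate with `1` in place of `1 + μ_*`.

The lemma on the logarithmic derivative (`exists_proximity_logDeriv_le`) is proved by splitting off
the zeros and poles in a disc of radius `R > r`. The logarithmic derivative of the zero-free part is
bounded pointwise by Harnack's inequality and the Borel–Carathéodory theorem, each split-off factor
contributes `|z - c|⁻¹`, whose square root has bounded circle averages, and concavity of the
logarithm passes from averages of square roots to averages of `log⁺`. Borel's growth lemma permits
`R = r + 1 / (2 T(r))` outside a set of finite measure.

That error terms absorb `log r` and constants rests on `log r = o(T(r, f))` for transcendental `f`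
(`IsTranscendentalMeromorphic.isLittleO_log_characteristic`): otherwise `f` has finitely many zeros
and poles, and the remaining zero-free entire factor has vanishing logarithmic derivative.
-/

namespace Nevanlinna

open Metric Real

/-! ### The logarithmic derivative of a holomorphic function without zeros -/

/-- A Harnack-type bound: by Poisson's formula a harmonic function inside the disc is controlled by
its mean absolute value on the boundary circle. -/
theorem abs_le_circleAverage_abs_of_harmonicOnNhd {u : ℂ → ℝ} {R : ℝ} {w : ℂ}
    (hu : InnerProductSpace.HarmonicOnNhd u (closedBall 0 R)) (hw : ‖w‖ < R) :
    |u w| ≤ (R + ‖w‖) / (R - ‖w‖) * circleAverage (fun z ↦ |u z|) 0 R := by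
  have hR : 0 < R := (norm_nonneg w).trans_lt hw
  have hw' : w ∈ ball (0 : ℂ) R := by simpa using hw
  have huc : ContinuousOn u (sphere 0 |R|) := by
    intro z hz
    rw [abs_of_pos hR] at hz
    exact (hu z (sphere_subset_closedBall hz)).1.continuousAt.continuousWithinAt
  have hker : ContinuousOn (fun z ↦ (herglotzRieszKernel 0 w z).re) (sphere 0 |R|) :=
    Complex.continuous_re.comp_continuousOn (continuousOn_herglotzRieszKernel_sphere hw')
  rw [← hu.circleAverage_re_herglotzRieszKernel_smul hw', ← smul_eq_mul (_ / _),
    ← circleAverage_fun_smul]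
  refine abs_circleAverage_le_circleAverage_abs.trans (circleAverage_mono ?_ ?_ fun z hz ↦ ?_)
  · exact ContinuousOn.circleIntegrable' (hker.smul huc).abs
  · exact ContinuousOn.circleIntegrable' (by fun_prop)
  · rw [abs_of_pos hR] at hz
    have h1 := re_herglotzRieszKernel_le hz hw'
    have h2 := le_re_herglotzRieszKernel hz hw'
    simp only [sub_zero] at h1 h2
    have h3 : 0 ≤ (R - ‖w‖) / (R + ‖w‖) :=
      div_nonneg (by linarith) (by positivity)
    change |(herglotzRieszKernel 0 w z).re * u z| ≤ _ * |u z|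
    rw [abs_mul, herglotzRieszKernel_def, sub_zero, sub_zero, abs_of_nonneg (h3.trans h2)]
    gcongr

/-- The logarithmic derivative is the derivative of a local logarithm `F` of `g`. The real part of
`F` is bounded near `z` through the harmonic function `log ‖g‖`, and the Borel–Carathéodory theorem
bounds the increments of `F` at `z`. -/
theorem norm_logDeriv_le_circleAverage_abs_log {g : ℂ → ℂ} {R : ℝ} {z : ℂ}
    (hg : AnalyticOnNhd ℂ g (closedBall 0 R)) (hg0 : ∀ w ∈ closedBall (0 : ℂ) R, g w ≠ 0)
    (hz : ‖z‖ < R) :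
    ‖logDeriv g z‖ ≤
      64 * R / (R - ‖z‖) ^ 2 * circleAverage (fun w ↦ |Real.log ‖g w‖|) 0 R := by
  have hR : 0 < R := (norm_nonneg z).trans_lt hz
  set A := circleAverage (fun w ↦ |Real.log ‖g w‖|) 0 R with hA
  have hA0 : 0 ≤ A := circleAverage_nonneg_of_nonneg fun _ _ ↦ abs_nonneg _
  set s := (R - ‖z‖) / 2 with hs
  have hs0 : 0 < s := by rw [hs]; linarith
  have hsub : ball z s ⊆ closedBall (0 : ℂ) R := by
    intro w hw
    rw [mem_ball, dist_eq_norm] at hw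
    rw [mem_closedBall, dist_zero_right]
    have := norm_le_norm_add_norm_sub' w z
    linarith
  have hbound : ∀ w ∈ ball z s, |Real.log ‖g w‖| ≤ 2 * R / s * A := by
    intro w hw
    rw [mem_ball, dist_eq_norm] at hw
    have h1 := norm_le_norm_add_norm_sub' w z
    have hw' : ‖w‖ < R := by linarith
    refine (abs_le_circleAverage_abs_of_harmonicOnNhd (u := fun w ↦ Real.log ‖g w‖)
      (fun x hx ↦ (hg x hx).harmonicAt_log_norm (hg0 x hx)) hw').trans ?_
    gcongr
    · linarith
    · linarith
  -- a holomorphic logarithm of `g` on the small disc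
  have hd : DifferentiableOn ℂ (logDeriv g) (ball z s) := fun w hw ↦
    (((hg w (hsub hw)).deriv.div (hg w (hsub hw)) (hg0 w (hsub hw))).differentiableAt
      ).differentiableWithinAt
  obtain ⟨F, hFz, hF⟩ := hd.isExactOn_ball.with_val_at z 0
  have hconst : ∀ w ∈ ball z s, g w * Complex.exp (-F w) = g z := by
    have hder : ∀ w ∈ ball z s, HasDerivAt (fun w ↦ g w * Complex.exp (-F w)) 0 w := by
      intro w hw
      have h1 := ((hg w (hsub hw)).differentiableAt.hasDerivAt).mul (hF w hw).neg.cexp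
      refine h1.congr_deriv ?_
      have := hg0 w (hsub hw)
      rw [logDeriv_apply, Pi.neg_apply]
      field_simp
      ring
    intro w hw
    have := (convex_ball z s).is_const_of_fderivWithin_eq_zero (𝕜 := ℂ)
      (f := fun w ↦ g w * Complex.exp (-F w))
      (fun x hx ↦ (hder x hx).differentiableAt.differentiableWithinAt)
      (fun x hx ↦ by
        rw [fderivWithin_of_isOpen isOpen_ball hx]
        ext
        simpa using (hder x hx).deriv) hw (mem_ball_self hs0)
    simpa [hFz] using this
  have hre : ∀ w ∈ ball z s, (F w).re = Real.log ‖g w‖ - Real.log ‖g z‖ := by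
    intro w hw
    rw [← hconst w hw, norm_mul, Complex.norm_exp, Real.log_mul
      (norm_ne_zero_iff.2 (hg0 w (hsub hw))) (Real.exp_ne_zero _), Real.log_exp]
    simp
  -- the Borel–Carathéodory theorem needs a positive bound, but `A` may vanish
  refine le_of_forall_pos_le_add fun ε hε ↦ ?_
  set M := 4 * R / s * A + ε * s / 4 with hM
  have hM0 : 0 < M := by positivity
  have hlip : ∀ᶠ w in 𝓝 z, ‖F w - F z‖ ≤ 4 * M / s * ‖w - z‖ := by
    filter_upwards [ball_mem_nhds z (half_pos hs0)] with w hw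
    have hw1 : ‖w - z‖ < s / 2 := by rwa [mem_ball, dist_eq_norm] at hw
    have key := Complex.borelCaratheodory_zero (f := fun ζ ↦ F (z + ζ)) (M := M) (R := s)
      (z := w - z) hM0 ?_ ?_ hs0 (by simpa using hw1.trans (half_lt_self hs0)) (by simpa using hFz)
    · simp only [add_sub_cancel] at key
      rw [hFz, sub_zero]
      refine key.trans ?_
      rw [div_mul_eq_mul_div, div_le_div_iff₀ (by linarith) hs0]
      have : 0 ≤ M * ‖w - z‖ := by positivity
      nlinarith
    · intro ζ hζ
      have : z + ζ ∈ ball z s := by simpa using hζ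
      exact ((hF _ this).differentiableAt.comp ζ
        (by fun_prop : DifferentiableAt ℂ (fun ζ ↦ z + ζ) ζ)).differentiableWithinAt
    · intro ζ hζ
      have hmem : z + ζ ∈ ball z s := by simpa using hζ
      have h1 := abs_le.1 (hbound _ hmem)
      have h2 := abs_le.1 (hbound _ (mem_ball_self hs0 : z ∈ ball z s))
      change (F (z + ζ)).re ≤ M
      rw [hre _ hmem]
      have : M = 2 * R / s * A + 2 * R / s * A + ε * s / 4 := by rw [hM]; ring
      have : 0 ≤ ε * s / 4 := by positivity
      linarith [h1.2, h2.1]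
  have := (hF z (mem_ball_self hs0)).le_of_lip' (by positivity) hlip
  refine this.trans (le_of_eq ?_)
  rw [hM]
  have : R - ‖z‖ = 2 * s := by rw [hs]; ring
  rw [this]
  field_simp
  ring

/-! ### Circle averages of `‖z - c‖ ^ (-1/2)` -/

theorem intervalIntegrable_inv_sqrt_abs_sin (a b : ℝ) :
    IntervalIntegrable (fun t ↦ (√|sin t|)⁻¹) volume a b := by
  have hper : Function.Periodic (fun t ↦ (√|sin t|)⁻¹) π := fun t ↦ by simp [sin_add_pi]
  refine hper.intervalIntegrable pi_ne_zero (t := 0) ?_ a b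
  rw [zero_add]
  -- Jordan's inequality compares `sin` with a linear function near each endpoint
  have h1 : IntervalIntegrable (fun t : ℝ ↦ t ^ (-(1 / 2) : ℝ)) volume 0 π :=
    intervalIntegral.intervalIntegrable_rpow' (by norm_num)
  have h2 : IntervalIntegrable (fun t : ℝ ↦ (π - t) ^ (-(1 / 2) : ℝ)) volume 0 π := by
    simpa using (h1.comp_sub_left π).symm
  refine ((h1.add h2).const_mul (√(π / 2))).mono_fun ?_ ?_
  · exact (by fun_prop : Measurable fun t ↦ (√|sin t|)⁻¹).aestronglyMeasurable
  · rw [uIoc_of_le pi_pos.le]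
    have hne : ∀ᵐ t : ℝ, t ≠ π := by
      simp [ae_iff, measure_singleton]
    refine (ae_restrict_iff' measurableSet_Ioc).2 (hne.mono fun t ht ht' ↦ ?_)
    have ht0 : 0 < t := ht'.1
    have htπ : 0 < π - t := sub_pos.2 (lt_of_le_of_ne ht'.2 ht)
    have hs : 0 < sin t := sin_pos_of_pos_of_lt_pi ht0 (by linarith)
    have key : ∀ x : ℝ, 0 < x → 2 / π * x ≤ sin t →
        (√|sin t|)⁻¹ ≤ √(π / 2) * x ^ (-(1 / 2) : ℝ) := by
      intro x hx hxs
      rw [rpow_neg hx.le, ← sqrt_eq_rpow, abs_of_pos hs, ← div_eq_mul_inv, ← sqrt_div (by positivity),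
        ← sqrt_inv]
      apply sqrt_le_sqrt
      rw [inv_le_comm₀ hs (by positivity)]
      refine le_trans (le_of_eq ?_) hxs
      field_simp
    have p1 : 0 ≤ t ^ (-(1 / 2) : ℝ) := by positivity
    have p2 : 0 ≤ (π - t) ^ (-(1 / 2) : ℝ) := by positivity
    beta_reduce
    rw [norm_of_nonneg (by positivity), norm_of_nonneg (by positivity), mul_add]
    rcases le_total t (π / 2) with h | h
    · have := key t ht0 (mul_le_sin ht0.le h)
      have : 0 ≤ √(π / 2) * (π - t) ^ (-(1 / 2) : ℝ) := by positivity
      linarith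
    · have := key (π - t) htπ (by
        rw [← sin_pi_sub]; exact mul_le_sin htπ.le (by linarith))
      have : 0 ≤ √(π / 2) * t ^ (-(1 / 2) : ℝ) := by positivity
      linarith

/-- The distance from a point of the circle to `c` is at least its distance to the line through the
origin and `c`. -/
theorem mul_abs_sin_le_norm_circleMap_sub (r θ : ℝ) (c : ℂ) (hr : 0 ≤ r) :
    r * |sin (θ - c.arg)| ≤ ‖circleMap 0 r θ - c‖ := by
  have h : ((circleMap 0 r θ - c) * Complex.exp (-(c.arg * Complex.I))).im
      = r * sin (θ - c.arg) := by
    have h1 : c * Complex.exp (-(c.arg * Complex.I)) = (‖c‖ : ℂ) := by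
      conv_lhs => rw [← Complex.norm_mul_exp_arg_mul_I c]
      rw [mul_assoc, Complex.norm_mul_exp_arg_mul_I c, ← Complex.exp_add]
      simp
    have h2 : circleMap 0 r θ * Complex.exp (-(c.arg * Complex.I))
        = r * Complex.exp ((θ - c.arg : ℝ) * Complex.I) := by
      rw [circleMap_zero, mul_assoc, ← Complex.exp_add]
      push_cast
      ring_nf
    rw [sub_mul, h1, h2, Complex.sub_im, Complex.ofReal_im, Complex.im_ofReal_mul, sub_zero,
      Complex.exp_ofReal_mul_I_im]
  calc r * |sin (θ - c.arg)| = |((circleMap 0 r θ - c) * Complex.exp (-(c.arg * Complex.I))).im| := by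
        rw [h, abs_mul, abs_of_nonneg hr]
    _ ≤ ‖(circleMap 0 r θ - c) * Complex.exp (-(c.arg * Complex.I))‖ := Complex.abs_im_le_norm _
    _ = ‖circleMap 0 r θ - c‖ := by
        rw [norm_mul, Complex.norm_exp]
        simp

theorem ae_sin_sub_ne_zero (α : ℝ) : ∀ᵐ θ : ℝ, sin (θ - α) ≠ 0 := by
  have : {θ : ℝ | sin (θ - α) = 0} ⊆ range fun n : ℤ ↦ n * π + α := by
    intro θ hθ
    obtain ⟨n, hn⟩ := sin_eq_zero_iff.1 hθ
    exact ⟨n, by simp only; linarith⟩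
  simpa [ae_iff] using! ((countable_range _).mono this).measure_zero volume

theorem inv_sqrt_norm_circleMap_sub_le {r θ : ℝ} {c : ℂ} (hr : 1 ≤ r)
    (hθ : sin (θ - c.arg) ≠ 0) :
    (√‖circleMap 0 r θ - c‖)⁻¹ ≤ (√|sin (θ - c.arg)|)⁻¹ := by
  have h := mul_abs_sin_le_norm_circleMap_sub r θ c (by linarith)
  have h0 : 0 < |sin (θ - c.arg)| := abs_pos.2 hθ
  have : |sin (θ - c.arg)| ≤ ‖circleMap 0 r θ - c‖ := by nlinarith
  gcongr

theorem circleIntegrable_inv_sqrt_norm_sub {r : ℝ} (c : ℂ) (hr : 1 ≤ r) :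
    CircleIntegrable (fun z ↦ (√‖z - c‖)⁻¹) 0 r := by
  have h : IntervalIntegrable (fun θ ↦ (√|sin (θ - c.arg)|)⁻¹) volume 0 (2 * π) := by
    simpa using (intervalIntegrable_inv_sqrt_abs_sin (0 - c.arg) (2 * π - c.arg)).comp_sub_right
      c.arg
  refine h.mono_fun ?_ ?_
  · exact (by fun_prop : Measurable fun θ ↦ (√‖circleMap 0 r θ - c‖)⁻¹).aestronglyMeasurable
  · refine ae_restrict_of_ae ((ae_sin_sub_ne_zero c.arg).mono fun θ hθ ↦ ?_)
    beta_reduce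
    rw [norm_of_nonneg (by positivity), norm_of_nonneg (by positivity)]
    exact inv_sqrt_norm_circleMap_sub_le hr hθ

/-- The bound is uniform in the centre `c`, including points on or near the circle, because the
exponent `1 / 2` makes the singularity integrable. -/
theorem exists_circleAverage_inv_sqrt_norm_sub_le :
    ∃ K : ℝ, 0 ≤ K ∧ ∀ (c : ℂ) (r : ℝ), 1 ≤ r →
      circleAverage (fun z ↦ (√‖z - c‖)⁻¹) 0 r ≤ K := by
  refine ⟨(2 * π)⁻¹ * ∫ t in 0..2 * π, (√|sin t|)⁻¹, mul_nonneg (by positivity)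
    (intervalIntegral.integral_nonneg two_pi_pos.le fun _ _ ↦ by positivity), fun c r hr ↦ ?_⟩
  have hper : Function.Periodic (fun t ↦ (√|sin t|)⁻¹) (2 * π) := fun t ↦ by simp
  have h : IntervalIntegrable (fun θ ↦ (√|sin (θ - c.arg)|)⁻¹) volume 0 (2 * π) := by
    simpa using (intervalIntegrable_inv_sqrt_abs_sin (0 - c.arg) (2 * π - c.arg)).comp_sub_right
      c.arg
  rw [circleAverage_def, smul_eq_mul]
  refine mul_le_mul_of_nonneg_left ?_ (by positivity)
  calc ∫ θ in 0..2 * π, (√‖circleMap 0 r θ - c‖)⁻¹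
      ≤ ∫ θ in 0..2 * π, (√|sin (θ - c.arg)|)⁻¹ :=
        intervalIntegral.integral_mono_ae two_pi_pos.le (circleIntegrable_inv_sqrt_norm_sub c hr) h
          ((ae_sin_sub_ne_zero c.arg).mono fun θ hθ ↦ inv_sqrt_norm_circleMap_sub_le hr hθ)
    _ = ∫ θ in (0 - c.arg)..(2 * π - c.arg), (√|sin θ|)⁻¹ :=
        intervalIntegral.integral_comp_sub_right (fun θ ↦ (√|sin θ|)⁻¹) c.arg
    _ = ∫ t in 0..2 * π, (√|sin t|)⁻¹ := by
        have := hper.intervalIntegral_add_eq (0 - c.arg) 0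
        rw [zero_add] at this
        rw [← this]
        congr 1
        ring

/-! ### Removing the zeros and poles in a disc -/

/-- Monotonicity of circle averages for an inequality that may fail at isolated points of the
circle. -/
theorem circleAverage_mono_codiscreteWithin {u v : ℂ → ℝ} {c : ℂ} {R : ℝ} (hR : R ≠ 0)
    (hu : CircleIntegrable u c R) (hv : CircleIntegrable v c R)
    (h : u ≤ᶠ[codiscreteWithin (sphere c |R|)] v) :
    circleAverage u c R ≤ circleAverage v c R := by
  have h1 : u =ᶠ[codiscreteWithin (sphere c |R|)] fun z ↦ min (u z) (v z) := by
    filter_upwards [h] with z hz using (min_eq_left hz).symm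
  rw [circleAverage_congr_codiscreteWithin h1 hR]
  exact circleAverage_mono (hu.congr_codiscreteWithin h1) hv fun z _ ↦ min_le_right _ _

theorem abs_log_eq (x : ℝ) : |log x| = log⁺ x + log⁺ x⁻¹ := by
  have h1 := half_mul_log_add_log_abs (x := x)
  have h2 := posLog_sub_posLog_inv (x := x)
  linarith

theorem circleIntegrable_abs_log_norm {f : ℂ → ℂ} (hf : Meromorphic f) (R : ℝ) :
    CircleIntegrable (fun z ↦ |log ‖f z‖|) 0 R :=
  (hf.meromorphicOn.circleIntegrable_log_norm).abs

theorem circleAverage_abs_log_norm {f : ℂ → ℂ} (hf : Meromorphic f) (R : ℝ) :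
    circleAverage (fun z ↦ |log ‖f z‖|) 0 R = proximity f ⊤ R + proximity f⁻¹ ⊤ R := by
  rw [proximity_top, proximity_top, ← circleAverage_fun_add
    hf.meromorphicOn.circleIntegrable_posLog_norm hf.inv.meromorphicOn.circleIntegrable_posLog_norm]
  simp [abs_log_eq]

/-- `|log x| = 2 log⁺ x - log x`, and for `u` in the disc the average of `log ‖z - u‖` is exactly
`log R`. -/
theorem circleAverage_abs_log_norm_sub_le {R : ℝ} {u : ℂ} (hR : 1 ≤ R) (hu : ‖u‖ ≤ R) :
    circleAverage (fun z ↦ |log ‖z - u‖|) 0 R ≤ 2 * log (2 * R) := by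
  have hm : Meromorphic fun z : ℂ ↦ z - u := by intro z; fun_prop
  have hR0 : |R| = R := abs_of_pos (by linarith)
  have e : (fun z : ℂ ↦ |log ‖z - u‖|) = fun z ↦ 2 * log⁺ ‖z - u‖ - log ‖z - u‖ := by
    ext z
    have := half_mul_log_add_log_abs (x := ‖z - u‖)
    linarith
  have i1 : CircleIntegrable (fun z ↦ log⁺ ‖z - u‖) 0 R :=
    hm.meromorphicOn.circleIntegrable_posLog_norm
  have i2 : CircleIntegrable (fun z ↦ log ‖z - u‖) 0 R :=
    hm.meromorphicOn.circleIntegrable_log_norm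
  have h1 : circleAverage (fun z ↦ log ‖z - u‖) 0 R = log R :=
    circleAverage_log_norm_sub_const_of_mem_closedBall (by simpa [hR0] using hu)
  have h2 : circleAverage (fun z ↦ log⁺ ‖z - u‖) 0 R ≤ log (2 * R) := by
    refine circleAverage_mono_on_of_le_circle i1 fun z hz ↦ ?_
    rw [hR0, mem_sphere, dist_zero_right] at hz
    rw [← posLog_eq_log (x := 2 * R) (by rw [abs_of_pos] <;> linarith)]
    exact posLog_le_posLog (norm_nonneg _) ((norm_sub_le _ _).trans (by linarith))
  have i3 : CircleIntegrable (fun z ↦ 2 * log⁺ ‖z - u‖) 0 R := i1.const_mul 2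
  rw [e, circleAverage_fun_sub i3 i2, h1]
  have : circleAverage (fun z ↦ 2 * log⁺ ‖z - u‖) 0 R =
      2 * circleAverage (fun z ↦ log⁺ ‖z - u‖) 0 R := by
    simpa using circleAverage_fun_smul (a := (2 : ℝ)) (f := fun z : ℂ ↦ log⁺ ‖z - u‖) (c := 0) (R := R)
  have := log_nonneg hR
  linarith

/-- If `f` is `g` times a finite product with divisor `D`, then `log ‖g‖` differs from `log ‖f‖` by
logarithms of distances to the points of `D`, each of mean absolute value at most `2 log (2 R)`. -/
theorem circleAverage_abs_log_norm_le_of_eventuallyEq {U : Set ℂ} {f g : ℂ → ℂ} {R : ℝ}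
    {D : locallyFinsuppWithin U ℤ} (hf : Meromorphic f) (hg : AnalyticOnNhd ℂ g U)
    (hg0 : ∀ u : U, g u ≠ 0) (hU : closedBall 0 R ⊆ U) (hD : D.support.Finite)
    (hDR : ∀ u ∈ D.support, ‖u‖ ≤ R) (hR : 1 ≤ R)
    (h : f =ᶠ[codiscreteWithin U] (∏ᶠ u, (· - u) ^ D u) • g) :
    circleAverage (fun z ↦ |log ‖g z‖|) 0 R ≤ proximity f ⊤ R + proximity f⁻¹ ⊤ R
      + (∑ u ∈ hD.toFinset, |(D u : ℝ)|) * (2 * log (2 * R)) := by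
  have hR0 : |R| = R := abs_of_pos (by linarith)
  have hgi : CircleIntegrable (fun z ↦ |log ‖g z‖|) 0 R := by
    refine CircleIntegrable.abs (f := fun z ↦ log ‖g z‖) (circleIntegrable_log_norm fun z hz ↦ ?_)
    exact (hg z (hU (sphere_subset_closedBall (by rwa [hR0] at hz)))).meromorphicAt
  have hsi : ∀ u ∈ hD.toFinset, CircleIntegrable (fun z ↦ |(D u : ℝ)| * |log ‖z - u‖|) 0 R :=
    fun u _ ↦ (circleIntegrable_abs_log_norm (f := fun z ↦ z - u) (by intro z; fun_prop) R).const_mul _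
  have hsum : CircleIntegrable
      (fun z ↦ ∑ u ∈ hD.toFinset, |(D u : ℝ)| * |log ‖z - u‖|) 0 R :=
    CircleIntegrable.fun_sum _ hsi
  calc circleAverage (fun z ↦ |log ‖g z‖|) 0 R
      ≤ circleAverage (fun z ↦ |log ‖f z‖| + ∑ u ∈ hD.toFinset, |(D u : ℝ)| * |log ‖z - u‖|) 0 R := by
        refine circleAverage_mono_codiscreteWithin (by linarith) hgi
          ((circleIntegrable_abs_log_norm hf R).add hsum) ?_
        have h1 := (extract_zeros_poles_log hg0 h).filter_mono (codiscreteWithin_mono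
          ((sphere_subset_closedBall.trans hU) : sphere 0 R ⊆ U))
        rw [hR0]
        filter_upwards [h1] with z hz
        have e : (∑ᶠ u, (fun x : ℂ ↦ (D u : ℝ) * log ‖x - u‖)) z
            = ∑ u ∈ hD.toFinset, (D u : ℝ) * log ‖z - u‖ := by
          rw [finsum_eq_sum_of_support_subset (s := hD.toFinset)]
          · simp
          · intro u hu
            simp only [Finite.coe_toFinset, Function.mem_support]
            rintro h0
            exact hu (by ext; simp [h0])
        rw [Pi.add_apply, e] at hz
        have h2 : |∑ u ∈ hD.toFinset, (D u : ℝ) * log ‖z - u‖|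
            ≤ ∑ u ∈ hD.toFinset, |(D u : ℝ)| * |log ‖z - u‖| := by
          refine (Finset.abs_sum_le_sum_abs _ _).trans (le_of_eq ?_)
          simp [abs_mul]
        have h3 : log ‖g z‖ = log ‖f z‖ - ∑ u ∈ hD.toFinset, (D u : ℝ) * log ‖z - u‖ := by
          linarith
        rw [h3]
        exact (abs_sub _ _).trans (by gcongr)
    _ = proximity f ⊤ R + proximity f⁻¹ ⊤ R
        + ∑ u ∈ hD.toFinset, |(D u : ℝ)| * circleAverage (fun z ↦ |log ‖z - u‖|) 0 R := by
        rw [circleAverage_fun_add (circleIntegrable_abs_log_norm hf R) hsum,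
          circleAverage_abs_log_norm hf, circleAverage_fun_sum hsi]
        congr 1
        refine Finset.sum_congr rfl fun u _ ↦ ?_
        simpa using circleAverage_fun_smul (a := |(D u : ℝ)|) (f := fun z : ℂ ↦ |log ‖z - u‖|)
          (c := 0) (R := R)
    _ ≤ _ := by
        rw [Finset.sum_mul]
        gcongr with u hu
        exact circleAverage_abs_log_norm_sub_le hR (hDR u (by simpa using hu))

/-- The number of zeros and poles of `f` in the closed disc of radius `R` around the origin,
counted with multiplicity. -/
noncomputable def divisorMass (f : ℂ → ℂ) (R : ℝ) : ℝ :=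
  ∑ᶠ c, |(divisor f (closedBall 0 R) c : ℝ)|

theorem finite_support_divisor_closedBall (f : ℂ → ℂ) (R : ℝ) :
    (divisor f (closedBall 0 R)).support.Finite :=
  (divisor f (closedBall 0 R)).finiteSupport (isCompact_closedBall 0 R)

theorem divisorMass_eq_sum (f : ℂ → ℂ) (R : ℝ) :
    divisorMass f R = ∑ c ∈ (finite_support_divisor_closedBall f R).toFinset,
      |(divisor f (closedBall 0 R) c : ℝ)| := by
  refine finsum_eq_sum_of_support_subset _ fun c hc ↦ ?_
  simpa using hc

theorem divisorMass_nonneg (f : ℂ → ℂ) (R : ℝ) : 0 ≤ divisorMass f R :=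
  finsum_nonneg fun _ ↦ abs_nonneg _

/-- A zero or pole in the disc of radius `R` contributes at least `log (R' / R)` to the counting
functions at radius `R'`. -/
theorem divisorMass_mul_log_le {f : ℂ → ℂ} (hf : Meromorphic f) {R R' : ℝ} (hR : 1 ≤ R)
    (hRR : R < R') :
    divisorMass f R * log (R' / R) ≤ logCounting f 0 R' + logCounting f ⊤ R' := by
  classical
  have hfin := finite_support_divisor_closedBall f R
  set D : locallyFinsupp ℂ ℤ := divisor f univ with hD
  set D' : locallyFinsupp ℂ ℤ := ∑ c ∈ hfin.toFinset,
    locallyFinsuppWithin.single c |divisor f (closedBall 0 R) c| with hD'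
  have hle : D' ≤ D⁺ + D⁻ := by
    intro z
    have h1 : D' z = ∑ c ∈ hfin.toFinset, if z = c then |divisor f (closedBall 0 R) c| else 0 := by
      simp [hD']
    have h2 : (D⁺ + D⁻) z = |D z| := by
      rw [locallyFinsuppWithin.coe_add, Pi.add_apply, locallyFinsuppWithin.posPart_apply,
        locallyFinsuppWithin.negPart_apply, posPart_add_negPart]
    rw [h1, h2, Finset.sum_ite_eq]
    split_ifs with hz
    · have hzb : z ∈ closedBall (0 : ℂ) R :=
        (divisor f (closedBall 0 R)).supportWithinDomain (by simpa using hz)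
      rw [divisor_apply hf.meromorphicOn hzb, hD, divisor_apply hf.meromorphicOn (mem_univ z)]
    · exact abs_nonneg _
  have h1 := locallyFinsuppWithin.logCounting_le hle (hR.trans hRR.le)
  rw [map_add, Pi.add_apply, ← logCounting_zero, ← logCounting_top] at h1
  refine le_trans ?_ h1
  rw [hD', map_sum, Finset.sum_apply, divisorMass_eq_sum, Finset.sum_mul]
  refine Finset.sum_le_sum fun c hc ↦ ?_
  have hcb : ‖c‖ ≤ R := by
    simpa using (divisor f (closedBall 0 R)).supportWithinDomain (by simpa using hc)
  rw [locallyFinsuppWithin.logCounting_single_eq_log_sub_const (hcb.trans hRR.le),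
    log_div (by linarith) (by linarith)]
  push_cast
  refine mul_le_mul_of_nonneg_left (sub_le_sub_left ?_ _) (abs_nonneg _)
  rcases eq_or_ne c 0 with rfl | h0
  · simpa using log_nonneg hR
  · exact log_le_log (norm_pos_iff.2 h0) hcb

/-- A pointwise bound on the circle of radius `r`, off the finitely many zeros and poles there: the
zero-free part is controlled by the characteristic at the larger radius `R`, and each zero or pole
`c` in the larger disc contributes `‖z - c‖⁻¹`. -/
theorem eventually_norm_logDeriv_le {f : ℂ → ℂ} (hf : Meromorphic f)
    (h0 : ∀ z, meromorphicOrderAt f z ≠ ⊤) {r R : ℝ} (hr : 0 < r) (hR : 1 ≤ R) (hrR : r < R) :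
    ∀ᶠ z in codiscreteWithin (sphere 0 |r|),
      ‖logDeriv f z‖ ≤ 64 * R / (R - r) ^ 2 * (proximity f ⊤ R + proximity f⁻¹ ⊤ R
        + divisorMass f R * (2 * log (2 * R)))
        + ∑ c ∈ (finite_support_divisor_closedBall f R).toFinset,
          |(divisor f (closedBall 0 R) c : ℝ)| * ‖z - c‖⁻¹ := by
  set U := closedBall (0 : ℂ) R with hU
  have hfin := finite_support_divisor_closedBall f R
  obtain ⟨g, hg, hg0, hfg⟩ := hf.meromorphicOn.extract_zeros_poles (U := U) (fun u ↦ h0 u) hfin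
  set D := divisor f U with hD
  have hA := circleAverage_abs_log_norm_le_of_eventuallyEq hf hg hg0 subset_rfl hfin
    (fun u hu ↦ by simpa [hU] using D.supportWithinDomain hu) hR hfg
  have hmass : (∑ u ∈ hfin.toFinset, |(D u : ℝ)|) = divisorMass f R := (divisorMass_eq_sum f R).symm
  rw [hmass] at hA
  have hP : MeromorphicOn (∏ᶠ u, (· - u) ^ D u) U :=
    (FactorizedRational.meromorphicNFOn D U).meromorphicOn
  have hP0 : ∀ x ∈ U, meromorphicOrderAt (∏ᶠ u, (· - u) ^ D u) x ≠ ⊤ := fun x _ ↦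
    FactorizedRational.meromorphicOrderAt_ne_top _
  have hgm : MeromorphicOn g U := hg.meromorphicOn
  have hgt : ∀ x ∈ U, meromorphicOrderAt g x ≠ ⊤ := fun x hx ↦ by
    rw [((hg x hx).meromorphicNFAt.meromorphicOrderAt_eq_zero_iff).2 (hg0 ⟨x, hx⟩)]
    simp
  have e1 := hf.meromorphicOn.deriv_eventuallyEq_codiscreteWithin (hP.smul hgm) hfg
  have e2 := hP.logDeriv_mul_eventuallyEq hgm hP0 hgt
  have e3 := MeromorphicOn.logDeriv_finprod_zpow_eventuallyEq (U := U) (F := fun u z ↦ z - u)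
    (d := D) hfin (fun i ↦ by intro z _; fun_prop) (fun i x _ ↦ by
      rw [meromorphicOrderAt_ne_top_iff_eventually_ne_zero (by fun_prop)]
      rcases eq_or_ne x i with rfl | h
      · filter_upwards [self_mem_nhdsWithin] with w hw using sub_ne_zero.2 hw
      · exact eventually_nhdsWithin_of_eventually_nhds
          ((continuous_id.sub continuous_const).continuousAt.eventually_ne (sub_ne_zero.2 h)))
  have hrU : sphere (0 : ℂ) |r| ⊆ U := by
    rw [abs_of_pos hr]
    exact sphere_subset_closedBall.trans (closedBall_subset_closedBall hrR.le)
  have e := codiscreteWithin_mono hrU ((hfg.and e1).and (e2.and e3))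
  filter_upwards [e, self_mem_codiscreteWithin _] with z hz hzs
  obtain ⟨⟨z1, z2⟩, z3, z4⟩ := hz
  rw [mem_sphere, dist_zero_right, abs_of_pos hr] at hzs
  have hlog : logDeriv f z = ∑ c ∈ hfin.toFinset, (D c : ℂ) * (z - c)⁻¹ + logDeriv g z := by
    have : logDeriv f z = logDeriv ((∏ᶠ u, (· - u) ^ D u) * g) z := by
      rw [logDeriv_apply, logDeriv_apply, z2, z1]
      rfl
    rw [this, z3, Pi.add_apply, z4]
    congr 1
    rw [finsum_eq_sum_of_support_subset (s := hfin.toFinset)]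
    · refine Finset.sum_congr rfl fun c _ ↦ ?_
      have : logDeriv (fun z ↦ z - c) z = (z - c)⁻¹ := by
        rw [logDeriv_apply]; simp
      rw [this]; simp
    · intro c hc
      simp only [Finite.coe_toFinset, Function.mem_support]
      rintro h
      exact hc (by simp [h])
  rw [hlog, add_comm]
  refine (norm_add_le _ _).trans (add_le_add ?_ ?_)
  · refine (norm_logDeriv_le_circleAverage_abs_log hg (fun w hw ↦ hg0 ⟨w, hw⟩)
      (by rwa [hzs])).trans ?_
    rw [hzs]
    gcongr
  · refine (norm_sum_le _ _).trans (Finset.sum_le_sum fun c _ ↦ ?_)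
    rw [norm_mul, norm_inv, Complex.norm_intCast]

/-! ### The lemma on the logarithmic derivative -/

theorem posLog_le_two_mul_log_one_add_sqrt {x : ℝ} (hx : 0 ≤ x) : log⁺ x ≤ 2 * log (1 + √x) := by
  have h1 : 0 ≤ √x := sqrt_nonneg x
  rw [posLog_eq_log_max_one hx, ← Nat.cast_ofNat (R := ℝ), ← log_pow]
  refine log_le_log (by positivity) (max_le ?_ ?_)
  · nlinarith
  · nlinarith [sq_sqrt hx]

theorem sqrt_sum_le_sum_sqrt {ι : Type*} (s : Finset ι) (a : ι → ℝ) (ha : ∀ i ∈ s, 0 ≤ a i) :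
    √(∑ i ∈ s, a i) ≤ ∑ i ∈ s, √(a i) := by
  refine sqrt_le_iff.2 ⟨Finset.sum_nonneg fun _ _ ↦ sqrt_nonneg _, ?_⟩
  calc ∑ i ∈ s, a i = ∑ i ∈ s, √(a i) ^ 2 := Finset.sum_congr rfl fun i hi ↦ (sq_sqrt (ha i hi)).symm
    _ ≤ _ := Finset.sum_sq_le_sq_sum_of_nonneg fun _ _ ↦ sqrt_nonneg _

theorem sqrt_add_le_sqrt_add_sqrt {a b : ℝ} (ha : 0 ≤ a) (hb : 0 ≤ b) : √(a + b) ≤ √a + √b := by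
  refine sqrt_le_iff.2 ⟨by positivity, ?_⟩
  nlinarith [sq_sqrt ha, sq_sqrt hb, mul_nonneg (sqrt_nonneg a) (sqrt_nonneg b)]

/-- The tangent-line bound for the concave function `log (1 + y)` at `A`. Averaging it with `A` at
least the mean of `y` is Jensen's inequality. -/
theorem log_one_add_le_add_div {A y : ℝ} (hA : 0 ≤ A) (hy : 0 ≤ y) :
    log (1 + y) ≤ log (1 + A) + (y - A) / (1 + A) := by
  have h := log_le_sub_one_of_pos (x := (1 + y) / (1 + A)) (by positivity)
  rw [log_div (by positivity) (by positivity)] at h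
  have : (1 + y) / (1 + A) - 1 = (y - A) / (1 + A) := by field_simp; ring
  linarith

/-- The lemma on the logarithmic derivative with an arbitrary second radius `R`, and with a constant
`K` that does not depend on `f`. -/
theorem exists_proximity_logDeriv_le_log :
    ∃ K : ℝ, 0 ≤ K ∧ ∀ f : ℂ → ℂ, Meromorphic f → (∀ z, meromorphicOrderAt f z ≠ ⊤) →
      ∀ r R : ℝ, 1 ≤ r → r < R → proximity (logDeriv f) ⊤ r ≤
        2 * log (1 + (√(64 * R / (R - r) ^ 2 * (proximity f ⊤ R + proximity f⁻¹ ⊤ R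
        + divisorMass f R * (2 * log (2 * R)))) + K * divisorMass f R)) := by
  obtain ⟨K, hK0, hK⟩ := exists_circleAverage_inv_sqrt_norm_sub_le
  refine ⟨K, hK0, fun f hf h0 r R hr hrR ↦ ?_⟩
  have hr0 : 0 < r := by linarith
  set B := 64 * R / (R - r) ^ 2 * (proximity f ⊤ R + proximity f⁻¹ ⊤ R
    + divisorMass f R * (2 * log (2 * R))) with hB
  have hB0 : 0 ≤ B := by
    have h1 := proximity_nonneg (f := f) (a := ⊤) R
    have h2 := proximity_nonneg (f := f⁻¹) (a := ⊤) R
    have h3 := divisorMass_nonneg f R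
    have h4 : 0 ≤ log (2 * R) := log_nonneg (by linarith)
    simp only [Pi.zero_apply] at h1 h2
    have : 0 < R := by linarith
    positivity
  set s := (finite_support_divisor_closedBall f R).toFinset with hs
  set d : ℂ → ℝ := fun c ↦ |(divisor f (closedBall 0 R) c : ℝ)| with hd
  have hd0 : ∀ c, 0 ≤ d c := fun c ↦ abs_nonneg _
  set A := √B + K * divisorMass f R with hA
  have hA0 : 0 ≤ A := add_nonneg (sqrt_nonneg _) (mul_nonneg hK0 (divisorMass_nonneg f R))
  set Y : ℂ → ℝ := fun z ↦ √B + ∑ c ∈ s, d c * (√‖z - c‖)⁻¹ with hY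
  have hY0 : ∀ z, 0 ≤ Y z := fun z ↦ add_nonneg (sqrt_nonneg _)
    (Finset.sum_nonneg fun c _ ↦ mul_nonneg (hd0 c) (by positivity))
  have hci : ∀ c ∈ s, CircleIntegrable (fun z ↦ d c * (√‖z - c‖)⁻¹) 0 r := fun c _ ↦
    (circleIntegrable_inv_sqrt_norm_sub c hr).const_mul _
  have hsi : CircleIntegrable (fun z ↦ ∑ c ∈ s, d c * (√‖z - c‖)⁻¹) 0 r :=
    CircleIntegrable.fun_sum _ hci
  have hYi : CircleIntegrable Y 0 r := (circleIntegrable_const _ _ _).add hsi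
  have hYavg : circleAverage Y 0 r ≤ A := by
    rw [hY, circleAverage_fun_add (circleIntegrable_const _ _ _) hsi, circleAverage_const,
      circleAverage_fun_sum hci, hA, divisorMass_eq_sum, Finset.mul_sum]
    gcongr with c hc
    have : circleAverage (fun z ↦ d c * (√‖z - c‖)⁻¹) 0 r
        = d c * circleAverage (fun z ↦ (√‖z - c‖)⁻¹) 0 r := by
      simpa using circleAverage_fun_smul (a := d c) (f := fun z : ℂ ↦ (√‖z - c‖)⁻¹) (c := 0) (R := r)
    rw [this, mul_comm]
    exact mul_le_mul_of_nonneg_right (hK c r hr) (hd0 c)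
  have hYi' : CircleIntegrable (fun z ↦ 2 / (1 + A) * Y z) 0 r := hYi.const_mul _
  have hGi : CircleIntegrable (fun z ↦ 2 * (log (1 + A) - A / (1 + A)) + 2 / (1 + A) * Y z) 0 r :=
    (circleIntegrable_const _ _ _).add hYi'
  rw [proximity_top]
  calc circleAverage (fun z ↦ log⁺ ‖logDeriv f z‖) 0 r
      ≤ circleAverage (fun z ↦ 2 * (log (1 + A) - A / (1 + A)) + 2 / (1 + A) * Y z) 0 r := by
        refine circleAverage_mono_codiscreteWithin hr0.ne'
          (hf.logDeriv.meromorphicOn.circleIntegrable_posLog_norm) hGi ?_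
        filter_upwards [eventually_norm_logDeriv_le hf h0 hr0 (hr.trans hrR.le) hrR] with z hz
        have h1 : √‖logDeriv f z‖ ≤ Y z := by
          refine (sqrt_le_sqrt hz).trans ?_
          refine (sqrt_add_le_sqrt_add_sqrt hB0 (Finset.sum_nonneg fun c _ ↦
            mul_nonneg (hd0 c) (by positivity))).trans ?_
          refine add_le_add le_rfl ((sqrt_sum_le_sum_sqrt _ _ fun c _ ↦
            mul_nonneg (hd0 c) (by positivity)).trans (Finset.sum_le_sum fun c _ ↦ ?_))
          rw [sqrt_mul (abs_nonneg _), sqrt_inv]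
          refine mul_le_mul_of_nonneg_right ?_ (by positivity)
          -- the multiplicities are integers, so they dominate their square roots
          have : d c = 0 ∨ 1 ≤ d c := by
            rw [hd]
            simp only
            rcases eq_or_ne (divisor f (closedBall 0 R) c) 0 with h | h
            · left; simp [h]
            · right; exact_mod_cast Int.one_le_abs h
          change √(d c) ≤ d c
          rcases this with h | h
          · simp [h]
          · exact sqrt_le_iff.2 ⟨by linarith, by nlinarith⟩
        have h2 := posLog_le_two_mul_log_one_add_sqrt (norm_nonneg (logDeriv f z))
        have h3 : log (1 + √‖logDeriv f z‖) ≤ log (1 + Y z) :=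
          log_le_log (by positivity) (by linarith)
        have h4 := log_one_add_le_add_div hA0 (hY0 z)
        have h5 : 2 * (log (1 + A) - A / (1 + A)) + 2 / (1 + A) * Y z
            = 2 * (log (1 + A) + (Y z - A) / (1 + A)) := by ring
        rw [h5]
        linarith
    _ = 2 * (log (1 + A) - A / (1 + A)) + 2 / (1 + A) * circleAverage Y 0 r := by
        rw [circleAverage_fun_add (circleIntegrable_const _ _ _) hYi',
          circleAverage_const]
        congr 1
        simpa using circleAverage_fun_smul (a := 2 / (1 + A)) (f := Y) (c := 0) (R := r)
    _ ≤ 2 * (log (1 + A) - A / (1 + A)) + 2 / (1 + A) * A := by gcongr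
    _ = 2 * log (1 + A) := by ring

/-- Borel's growth lemma: a nondecreasing `φ ≥ 1` satisfies `φ (r + 1 / φ r) ≤ 2 φ r` outside a set
of finite measure. The exceptional points with `2 ^ n ≤ φ r < 2 ^ (n + 1)` form a set of diameter at
most `2 ^ (-n)`. -/
theorem volume_setOf_two_mul_lt_lt_top {φ : ℝ → ℝ} (hφ : MonotoneOn φ (Ici 1))
    (h1 : ∀ r, 1 ≤ φ r) :
    volume {r : ℝ | 1 ≤ r ∧ 2 * φ r < φ (r + (φ r)⁻¹)} < ⊤ := by
  set E : ℕ → Set ℝ := fun n ↦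
    {r : ℝ | (1 ≤ r ∧ 2 * φ r < φ (r + (φ r)⁻¹)) ∧ 2 ^ n ≤ φ r ∧ φ r < 2 ^ (n + 1)} with hE
  have hsub : {r : ℝ | 1 ≤ r ∧ 2 * φ r < φ (r + (φ r)⁻¹)} ⊆ ⋃ n, E n := by
    intro r hr
    obtain ⟨n, hn⟩ := exists_nat_pow_near (h1 r) one_lt_two
    exact mem_iUnion.2 ⟨n, hr, hn.1, hn.2⟩
  -- two points of `E n` further apart than `2 ^ (-n)` would force `φ` to leave the dyadic range
  have hgap : ∀ n, ∀ r ∈ E n, ∀ s ∈ E n, s - r ≤ (1 / 2) ^ n := by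
    intro n r hr s hs
    by_contra! h
    have hpos : (0 : ℝ) < 2 ^ n := by positivity
    have hinv : (φ r)⁻¹ ≤ (1 / 2) ^ n := by
      rw [one_div, inv_pow]
      exact inv_anti₀ hpos hr.2.1
    have h0 : 0 ≤ (φ r)⁻¹ := inv_nonneg.2 (by linarith [h1 r])
    have h2 : φ (r + (φ r)⁻¹) ≤ φ s :=
      hφ (mem_Ici.2 (by linarith [hr.1.1])) hs.1.1 (by linarith)
    have h3 := hr.1.2
    have h4 := hs.2.2
    rw [pow_succ] at h4
    linarith [hr.2.1]
  have hvol : ∀ n, volume (E n) ≤ ENNReal.ofReal ((1 / 2) ^ n) := by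
    intro n
    refine (Real.volume_le_diam _).trans (Metric.ediam_le fun r hr s hs ↦ ?_)
    rw [edist_dist]
    refine ENNReal.ofReal_le_ofReal ?_
    rw [Real.dist_eq]
    exact abs_le.2 ⟨by linarith [hgap n r hr s hs], hgap n s hs r hr⟩
  calc volume {r : ℝ | 1 ≤ r ∧ 2 * φ r < φ (r + (φ r)⁻¹)}
      ≤ volume (⋃ n, E n) := measure_mono hsub
    _ ≤ ∑' n, volume (E n) := measure_iUnion_le _
    _ ≤ ∑' n, ENNReal.ofReal ((1 / 2) ^ n) := ENNReal.tsum_le_tsum hvol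
    _ = ENNReal.ofReal (∑' n : ℕ, (1 / 2) ^ n) :=
        (ENNReal.ofReal_tsum_of_nonneg (fun n ↦ by positivity) summable_geometric_two).symm
    _ < ⊤ := ENNReal.ofReal_lt_top

/-- The first main theorem for `f` and `1 / f`. -/
theorem exists_characteristic_inv_le {f : ℂ → ℂ} (hf : Meromorphic f) :
    ∃ c : ℝ, 0 ≤ c ∧ ∀ r, characteristic f⁻¹ ⊤ r ≤ characteristic f ⊤ r + c := by
  refine ⟨max |log ‖f 0‖| |log ‖meromorphicTrailingCoeffAt f 0‖|,
    le_max_of_le_left (abs_nonneg _), fun r ↦ ?_⟩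
  have := (abs_le.1 (characteristic_sub_characteristic_inv_le hf (R := r))).1
  linarith

/-- The numerical part of the lemma on the logarithmic derivative: for `R = r + 1 / (2 X)` all
quantities are polynomially bounded in `r + 1` and `X`. Here `p` stands for the proximity terms and
`m` for the number of zeros and poles. -/
theorem two_mul_log_one_add_le {K c X r R p m : ℝ} (hK0 : 0 ≤ K) (hc0 : 0 ≤ c) (hX1 : 1 ≤ X)
    (hr : 1 ≤ r) (hR : R = r + X⁻¹ / 2) (hp0 : 0 ≤ p) (hp : p ≤ (4 + c) * X) (hm0 : 0 ≤ m)
    (hm : m ≤ 2 * (4 + c) * X ^ 2 * (r + 1)) :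
    2 * log (1 + (√(64 * R / (R - r) ^ 2 * (p + m * (2 * log (2 * R)))) + K * m)) ≤
      (2 * log (2 + 2304 * (4 + c) + 2 * K * (4 + c)) + 8) * (1 + log (r + 1) + log X) := by
  set Q : ℝ := 2 + 2304 * (4 + c) + 2 * K * (4 + c) with hQ
  have hKc : 0 ≤ K * (4 + c) := by positivity
  have hQ1 : 1 ≤ Q := by linarith
  have hX0 : 0 < X := by linarith
  have hXi : X⁻¹ ≤ 1 := inv_le_one_of_one_le₀ hX1
  have hXi0 : 0 < X⁻¹ := inv_pos.2 hX0
  have hR1 : 1 ≤ R := by linarith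
  have hRr : R ≤ r + 1 := by linarith
  have hlogR : log (2 * R) ≤ 2 * (r + 1) := by
    have := log_le_sub_one_of_pos (x := 2 * R) (by linarith)
    linarith
  have hlogR0 : 0 ≤ log (2 * R) := log_nonneg (by linarith)
  have hY1 : 1 ≤ r + 1 := by linarith
  set P := (r + 1) ^ 3 * X ^ 4 with hP
  set B := 64 * R / (R - r) ^ 2 * (p + m * (2 * log (2 * R))) with hB
  have hB1 : B ≤ 2304 * (4 + c) * P := by
    have e1 : 64 * R / (R - r) ^ 2 = 256 * X ^ 2 * R := by
      have : R - r = X⁻¹ / 2 := by rw [hR]; ring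
      rw [this]
      field_simp
      ring
    have e2 : p + m * (2 * log (2 * R)) ≤ 9 * ((4 + c) * X ^ 2 * (r + 1) ^ 2) := by
      have a1 : m * (2 * log (2 * R))
          ≤ 2 * (4 + c) * X ^ 2 * (r + 1) * (2 * (2 * (r + 1))) := by gcongr
      have a2 : (4 + c) * X ≤ (4 + c) * X ^ 2 * (r + 1) ^ 2 := by
        have b1 : X ≤ X ^ 2 := le_self_pow₀ hX1 (by norm_num)
        have b2 : (1 : ℝ) ≤ (r + 1) ^ 2 := one_le_pow₀ hY1
        calc (4 + c) * X ≤ (4 + c) * X ^ 2 := by gcongr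
          _ ≤ (4 + c) * X ^ 2 * (r + 1) ^ 2 := le_mul_of_one_le_right (by positivity) b2
      linarith
    rw [hB, e1]
    calc 256 * X ^ 2 * R * (p + m * (2 * log (2 * R)))
        ≤ 256 * X ^ 2 * (r + 1) * (9 * ((4 + c) * X ^ 2 * (r + 1) ^ 2)) := by gcongr
      _ = _ := by rw [hP]; ring
  have hB0 : 0 ≤ B := by
    rw [hB]
    have : 0 < R := by linarith
    positivity
  have hP1 : 1 ≤ P := one_le_mul_of_one_le_of_one_le (one_le_pow₀ hY1) (one_le_pow₀ hX1)
  have harg : 1 + (√B + K * m) ≤ Q * P := by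
    have a1 : √B ≤ 1 + B := sqrt_le_iff.2 ⟨by linarith, by nlinarith⟩
    have a2 : K * m ≤ 2 * K * (4 + c) * P := by
      have b1 : X ^ 2 ≤ X ^ 4 := pow_le_pow_right₀ hX1 (by norm_num)
      have b2 : r + 1 ≤ (r + 1) ^ 3 := le_self_pow₀ hY1 (by norm_num)
      calc K * m ≤ K * (2 * (4 + c) * X ^ 4 * (r + 1) ^ 3) := by
            gcongr
            exact hm.trans (by gcongr)
        _ = _ := by rw [hP]; ring
    rw [hQ, add_mul, add_mul]
    linarith
  have hlog : log (1 + (√B + K * m)) ≤ log Q + (3 * log (r + 1) + 4 * log X) := by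
    refine (log_le_log (by positivity) harg).trans (le_of_eq ?_)
    rw [log_mul (by positivity) (by positivity), hP, log_mul (by positivity) (by positivity),
      log_pow, log_pow]
    push_cast
    ring
  have l1 := log_nonneg hQ1
  have l2 := log_nonneg hY1
  have l3 := log_nonneg hX1
  clear_value Q B P
  have := mul_nonneg l1 l2
  have := mul_nonneg l1 l3
  linarith

theorem proximity_le_characteristic {f : ℂ → ℂ} {r : ℝ} (hr : 1 ≤ r) :
    proximity f ⊤ r ≤ characteristic f ⊤ r := by
  simp only [characteristic, Pi.add_apply]
  linarith [logCounting_nonneg (f := f) (e := ⊤) hr]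

theorem logCounting_le_characteristic {f : ℂ → ℂ} {a : WithTop ℂ} (r : ℝ) :
    logCounting f a r ≤ characteristic f a r := by
  have := proximity_nonneg (f := f) (a := a) r
  simp only [characteristic, Pi.add_apply]
  simp only [Pi.zero_apply] at this
  linarith

/-- The lemma on the logarithmic derivative: `m(r, f' / f) = O(1 + log r + log⁺ T(r, f))` outside a
set of finite measure. -/
theorem exists_proximity_logDeriv_le {f : ℂ → ℂ} (hf : Meromorphic f)
    (h0 : ∀ z, meromorphicOrderAt f z ≠ ⊤) :
    ∃ C : ℝ, 0 ≤ C ∧ ∃ E : Set ℝ, volume E < ⊤ ∧ ∀ r, 1 ≤ r → r ∉ E →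
      proximity (logDeriv f) ⊤ r ≤
        C * (1 + log (r + 1) + log (max 1 (characteristic f ⊤ r))) := by
  obtain ⟨K, hK0, hK⟩ := exists_proximity_logDeriv_le_log
  obtain ⟨c, hc0, hc⟩ := exists_characteristic_inv_le hf
  set φ : ℝ → ℝ := fun r ↦ max 1 (characteristic f ⊤ r) with hφ
  have hmono : MonotoneOn φ (Ici 1) := fun a ha b hb hab ↦ max_le_max le_rfl
    (characteristic_monotoneOn hf (mem_Ioi.2 (by linarith [mem_Ici.1 ha]))
      (mem_Ioi.2 (by linarith [mem_Ici.1 hb])) hab)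
  have h1 : ∀ r, 1 ≤ φ r := fun r ↦ le_max_left _ _
  have hQ1 : 1 ≤ 2 + 2304 * (4 + c) + 2 * K * (4 + c) := by
    have : 0 ≤ K * (4 + c) := by positivity
    linarith
  refine ⟨2 * log (2 + 2304 * (4 + c) + 2 * K * (4 + c)) + 8, by linarith [log_nonneg hQ1], _,
    volume_setOf_two_mul_lt_lt_top hmono h1, fun r hr hrE ↦ ?_⟩
  set X := φ r with hX
  have hX1 : 1 ≤ X := h1 r
  have hX0 : 0 < X := by linarith
  have hXi : X⁻¹ ≤ 1 := inv_le_one_of_one_le₀ hX1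
  have hXi0 : 0 < X⁻¹ := inv_pos.2 hX0
  have hbad : φ (r + X⁻¹) ≤ 2 * X := by
    by_contra! h
    exact hrE ⟨hr, h⟩
  -- `R` is the radius of the disc whose zeros and poles are split off; their number is bounded by
  -- the characteristic at the larger radius `R'`, where Borel's lemma applies
  set R' := r + X⁻¹ with hR'
  set R := r + X⁻¹ / 2 with hR
  have hrR : r < R := by rw [hR]; linarith
  have hRR' : R < R' := by rw [hR, hR']; linarith
  have hR1 : 1 ≤ R := hr.trans hrR.le
  have hT : characteristic f ⊤ R' ≤ 2 * X := (le_max_right _ _).trans hbad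
  have hTR : characteristic f ⊤ R ≤ 2 * X :=
    (characteristic_monotoneOn hf (mem_Ioi.2 (by linarith)) (mem_Ioi.2 (by linarith))
      hRR'.le).trans hT
  have hprox : proximity f ⊤ R + proximity f⁻¹ ⊤ R ≤ (4 + c) * X := by
    have e1 : proximity f ⊤ R ≤ characteristic f ⊤ R := proximity_le_characteristic hR1
    have e2 : proximity f⁻¹ ⊤ R ≤ characteristic f⁻¹ ⊤ R := proximity_le_characteristic hR1
    nlinarith [hc R, mul_nonneg hc0 (sub_nonneg.2 hX1)]
  have hmass : divisorMass f R ≤ 2 * (4 + c) * X ^ 2 * (r + 1) := by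
    have e0 := divisorMass_mul_log_le hf hR1 hRR'
    have e1 : logCounting f ⊤ R' ≤ characteristic f ⊤ R' := logCounting_le_characteristic R'
    have e2 : logCounting f 0 R' ≤ characteristic f⁻¹ ⊤ R' := by
      rw [← logCounting_inv]
      exact logCounting_le_characteristic R'
    have e3 : divisorMass f R * log (R' / R) ≤ (4 + c) * X := by
      nlinarith [hc R', mul_nonneg hc0 (sub_nonneg.2 hX1)]
    have e4 : (2 * X * (r + 1))⁻¹ ≤ log (R' / R) := by
      refine le_trans ?_ (one_sub_inv_le_log_of_pos (div_pos (by linarith) (by linarith)))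
      rw [inv_div, one_sub_div (by linarith), inv_le_comm₀ (by positivity)
        (div_pos (by linarith) (by linarith)), inv_div]
      have : R' - R = X⁻¹ / 2 := by rw [hR, hR']; ring
      rw [this]
      have : R' / (X⁻¹ / 2) = 2 * X * R' := by field_simp
      rw [this]
      gcongr
      linarith
    have e5 : divisorMass f R * (2 * X * (r + 1))⁻¹ ≤ (4 + c) * X :=
      (mul_le_mul_of_nonneg_left e4 (divisorMass_nonneg f R)).trans e3
    rw [← div_eq_mul_inv, div_le_iff₀ (by positivity)] at e5
    linarith
  exact (hK f hf h0 r R hr hrR).trans (two_mul_log_one_add_le hK0 hc0 hX1 hr hR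
    (add_nonneg (proximity_nonneg (f := f) (a := ⊤) R) (proximity_nonneg (f := f⁻¹) (a := ⊤) R))
    hprox (divisorMass_nonneg f R) hmass)

/-! ### Growth of the characteristic of a transcendental function -/

theorem zpow_eq_pow_div_pow {K : Type*} [Field K] (x : K) (n : ℤ) :
    x ^ n = x ^ n.toNat / x ^ (-n).toNat := by
  rcases le_total 0 n with h | h
  · rw [Int.toNat_of_nonpos (by omega : -n ≤ 0), pow_zero, div_one, ← zpow_natCast,
      Int.toNat_of_nonneg h]
  · rw [Int.toNat_of_nonpos h, pow_zero, one_div, ← zpow_natCast, Int.toNat_of_nonneg (by omega),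
      zpow_neg, inv_inv]

/-- The values at the points of `D` agree as well, since `0⁻¹ = 0` and `x / 0 = 0`. -/
theorem exists_polynomial_finprod_zpow (D : ℂ → ℤ) (hD : D.support.Finite) (c : ℂ) :
    ∃ P Q : ℂ[X], Q ≠ 0 ∧ ∀ z, (∏ᶠ u, (fun z : ℂ ↦ z - u) ^ D u) z * c = P.eval z / Q.eval z := by
  refine ⟨(∏ u ∈ hD.toFinset, (Polynomial.X - Polynomial.C u) ^ (D u).toNat) * Polynomial.C c,
    ∏ u ∈ hD.toFinset, (Polynomial.X - Polynomial.C u) ^ (-D u).toNat,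
    Finset.prod_ne_zero_iff.2 fun u _ ↦ pow_ne_zero _ (Polynomial.X_sub_C_ne_zero u),
    fun z ↦ ?_⟩
  rw [finprod_eq_prod_of_mulSupport_subset (s := hD.toFinset)]
  · simp only [Finset.prod_apply, Pi.pow_apply, Polynomial.eval_mul, Polynomial.eval_prod,
      Polynomial.eval_pow, Polynomial.eval_sub, Polynomial.eval_X, Polynomial.eval_C]
    rw [mul_div_right_comm, ← Finset.prod_div_distrib]
    congr 1
    exact Finset.prod_congr rfl fun u _ ↦ zpow_eq_pow_div_pow _ _
  · intro u hu
    simp only [Finite.coe_toFinset, Function.mem_support]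
    rintro h
    exact hu (by simp [h])

/-- A function of at most logarithmic growth along some sequence of radii has finitely many zeros
and poles. -/
theorem finite_support_divisor_of_frequently_le_log {f : ℂ → ℂ} (hf : Meromorphic f) {C : ℝ}
    (h : ∃ᶠ R in atTop, characteristic f ⊤ R ≤ C * log R) :
    (divisor f univ).support.Finite := by
  obtain ⟨c, hc0, hc⟩ := exists_characteristic_inv_le hf
  have hmass : ∀ r, 1 ≤ r → divisorMass f r ≤ 2 * (2 * C + c) := by
    intro r hr
    obtain ⟨R, hR, hRr, hRe⟩ :=
      (h.and_eventually ((eventually_gt_atTop (r ^ 2)).and (eventually_ge_atTop (exp 1)))).exists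
    -- `R > r ^ 2` makes `log (R / r)` at least half of `log R`
    have hrR : r < R := by nlinarith
    have hR0 : 0 < R := by linarith
    have hlog1 : 1 ≤ log R := (le_log_iff_exp_le hR0).2 hRe
    have e1 : logCounting f 0 R ≤ characteristic f⁻¹ ⊤ R := by
      rw [← logCounting_inv]
      exact logCounting_le_characteristic R
    have e2 := logCounting_le_characteristic (f := f) (a := ⊤) R
    have e3 := divisorMass_mul_log_le hf hr hrR
    have e4 : log R / 2 ≤ log (R / r) := by
      rw [log_div (by linarith) (by linarith)]
      have : log (r ^ 2) ≤ log R := log_le_log (by positivity) hRr.le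
      rw [log_pow] at this
      push_cast at this
      linarith
    have e5 : divisorMass f r * (log R / 2) ≤ (2 * C + c) * log R := by
      refine (mul_le_mul_of_nonneg_left e4 (divisorMass_nonneg f r)).trans ?_
      have := hc R
      have : c ≤ c * log R := le_mul_of_one_le_right hc0 hlog1
      linarith
    have e6 : divisorMass f r * log R ≤ 2 * (2 * C + c) * log R := by linarith
    exact le_of_mul_le_mul_right e6 (by linarith)
  by_contra hinf
  obtain ⟨n, hn⟩ := exists_nat_gt (2 * (2 * C + c))
  obtain ⟨s, hs, hsn⟩ := Set.Infinite.exists_subset_card_eq hinf n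
  obtain ⟨r, hr⟩ := s.finite_toSet.isBounded.subset_closedBall (0 : ℂ)
  have hr1 : (s : Set ℂ) ⊆ closedBall 0 (max 1 r) :=
    hr.trans (closedBall_subset_closedBall (le_max_right _ _))
  have key : (n : ℝ) ≤ divisorMass f (max 1 r) := by
    rw [divisorMass_eq_sum, ← hsn, Finset.cast_card]
    have heq : ∀ u ∈ s, divisor f (closedBall 0 (max 1 r)) u = divisor f univ u := fun u hu ↦ by
      rw [divisor_apply hf.meromorphicOn (hr1 hu), divisor_apply hf.meromorphicOn (mem_univ u)]
    calc ∑ u ∈ s, (1 : ℝ) ≤ ∑ u ∈ s, |(divisor f (closedBall 0 (max 1 r)) u : ℝ)| := by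
          refine Finset.sum_le_sum fun u hu ↦ ?_
          rw [heq u hu]
          exact_mod_cast Int.one_le_abs (hs hu)
      _ ≤ _ := by
          refine Finset.sum_le_sum_of_subset_of_nonneg (fun u hu ↦ ?_) fun _ _ _ ↦ abs_nonneg _
          simp only [Finite.mem_toFinset, Function.mem_support]
          rw [heq u hu]
          exact hs hu
  linarith [hmass _ (le_max_left 1 r)]

theorem tendsto_mul_log_div_sq (a b : ℝ) :
    Tendsto (fun R ↦ 64 * R / (R - a) ^ 2 * (b * log R)) atTop (𝓝 0) := by
  have h1 : Tendsto (fun R : ℝ ↦ log R / R) atTop (𝓝 0) :=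
    (isLittleO_log_id_atTop.tendsto_div_nhds_zero)
  have h2 : Tendsto (fun R : ℝ ↦ 1 - a / R) atTop (𝓝 1) := by
    simpa using (tendsto_const_nhds (x := (1 : ℝ))).sub (tendsto_const_nhds.div_atTop tendsto_id)
  have h3 : Tendsto (fun R : ℝ ↦ 64 * b * (log R / R) / (1 - a / R) ^ 2) atTop (𝓝 0) := by
    have := (h1.const_mul (64 * b)).div (h2.pow 2) (by norm_num)
    rw [mul_zero, zero_div] at this
    exact this
  refine h3.congr' ?_
  filter_upwards [eventually_gt_atTop 0, eventually_gt_atTop a] with R hR hRa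
  have : R - a ≠ 0 := by linarith
  have h : (1 - a / R) = (R - a) / R := by field_simp
  rw [h]
  field_simp

/-- A property holds off a closed discrete set if and only if it holds on a punctured neighbourhood
of every point. -/
theorem eventually_codiscrete_iff {p : ℂ → Prop} :
    (∀ᶠ z in codiscrete ℂ, p z) ↔ ∀ z, ∀ᶠ w in 𝓝[≠] z, p w := by
  rw [Filter.Eventually, codiscrete, mem_codiscreteWithin_iff_forall_mem_nhdsNE]
  simp [Filter.Eventually]

theorem eventuallyEq_zero_of_meromorphicOrderAt_eq_top {f : ℂ → ℂ} (hf : Meromorphic f) {z : ℂ}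
    (h : meromorphicOrderAt f z = ⊤) : f =ᶠ[codiscrete ℂ] fun _ ↦ 0 := by
  have : ∀ z, meromorphicOrderAt f z = ⊤ := by
    by_contra! h'
    exact (hf.exists_meromorphicOrderAt_ne_top_iff_forall.1 h') z h
  exact eventually_codiscrete_iff.2 fun w ↦ meromorphicOrderAt_eq_top_iff.1 (this w)

theorem IsTranscendentalMeromorphic.order_ne_top {f : ℂ → ℂ}
    (hf : IsTranscendentalMeromorphic f) (z : ℂ) : meromorphicOrderAt f z ≠ ⊤ := by
  intro h
  refine hf.2 ⟨0, 1, one_ne_zero, ?_⟩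
  filter_upwards [eventuallyEq_zero_of_meromorphicOrderAt_eq_top hf.1 h] with w hw
  simp [hw]

/-- After division by a rational function with the same finite divisor, `f` becomes a zero-free
entire function `g` with `∫ |log ‖g‖| = O(log R)` for arbitrarily large `R`, so that `g' / g = 0`.
-/
theorem IsTranscendentalMeromorphic.not_frequently_le_log {f : ℂ → ℂ}
    (hf : IsTranscendentalMeromorphic f) {C : ℝ} :
    ¬ ∃ᶠ R in atTop, characteristic f ⊤ R ≤ C * log R := by
  intro h
  have hfin := finite_support_divisor_of_frequently_le_log hf.1 h
  obtain ⟨g, hg, hg0, hfg⟩ := hf.1.meromorphicOn.extract_zeros_poles (U := univ)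
    (fun u ↦ hf.order_ne_top u) hfin
  obtain ⟨c, hc0, hc⟩ := exists_characteristic_inv_le hf.1
  obtain ⟨ρ, hρ⟩ := hfin.isBounded.subset_closedBall (0 : ℂ)
  set m := ∑ u ∈ hfin.toFinset, |(divisor f univ u : ℝ)| with hm
  have hm0 : 0 ≤ m := Finset.sum_nonneg fun _ _ ↦ abs_nonneg _
  have hfreq : ∃ᶠ R in atTop, circleAverage (fun z ↦ |log ‖g z‖|) 0 R
      ≤ (2 * C + c + 4 * m) * log R := by
    refine (h.and_eventually ((eventually_ge_atTop ρ).and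
      (eventually_ge_atTop (exp 1)))).mono fun R ⟨hR, hRρ, hRe⟩ ↦ ?_
    have he : 2 ≤ exp 1 := by linarith [add_one_le_exp (1 : ℝ)]
    have hR0 : 0 < R := by linarith
    have hR1 : 1 ≤ R := by linarith
    have hlog1 : 1 ≤ log R := (le_log_iff_exp_le hR0).2 hRe
    refine (circleAverage_abs_log_norm_le_of_eventuallyEq hf.1 hg hg0 (subset_univ _) hfin
      (fun u hu ↦ by simpa using (hρ hu).trans hRρ) hR1 hfg).trans ?_
    have e1 := proximity_le_characteristic (f := f) hR1
    have e2 := proximity_le_characteristic (f := f⁻¹) hR1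
    have e3 := hc R
    have e4 : log (2 * R) ≤ 2 * log R := by
      rw [log_mul (by norm_num) hR0.ne']
      linarith [log_le_log (by norm_num) (he.trans hRe)]
    have e5 : m * (2 * log (2 * R)) ≤ m * (2 * (2 * log R)) := by gcongr
    have e6 : c ≤ c * log R := le_mul_of_one_le_right hc0 hlog1
    linarith
  have hderiv : ∀ z, deriv g z = 0 := by
    intro z
    have hz : ‖logDeriv g z‖ ≤ 0 := by
      by_contra! hpos
      have hev := (tendsto_mul_log_div_sq ‖z‖ (2 * C + c + 4 * m)).eventually (gt_mem_nhds hpos)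
      obtain ⟨R, hR, hR1, hR2⟩ := (hfreq.and_eventually (hev.and
        (eventually_gt_atTop ‖z‖))).exists
      refine absurd hR1 (not_lt.2 ?_)
      refine (norm_logDeriv_le_circleAverage_abs_log (hg.mono (subset_univ _))
        (fun w _ ↦ hg0 ⟨w, mem_univ w⟩) hR2).trans ?_
      have : 0 ≤ R := (norm_nonneg z).trans hR2.le
      gcongr
    have hz0 : logDeriv g z = 0 := norm_le_zero_iff.1 hz
    rw [logDeriv_apply, div_eq_zero_iff] at hz0
    exact hz0.resolve_right (hg0 ⟨z, mem_univ z⟩)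
  have hconst : ∀ z, g z = g 0 := fun z ↦ is_const_of_deriv_eq_zero
    (fun w ↦ (hg w (mem_univ w)).differentiableAt) hderiv z 0
  obtain ⟨P, Q, hQ, hPQ⟩ := exists_polynomial_finprod_zpow (divisor f univ) hfin (g 0)
  refine hf.2 ⟨P, Q, hQ, ?_⟩
  filter_upwards [hfg] with z hz
  rw [hz, ← hPQ z, Pi.smul_apply', smul_eq_mul, hconst z]

theorem IsTranscendentalMeromorphic.isLittleO_log_characteristic {f : ℂ → ℂ}
    (hf : IsTranscendentalMeromorphic f) : log =o[atTop] characteristic f ⊤ := by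
  refine Asymptotics.isLittleO_iff.2 fun ε hε ↦ ?_
  have h := hf.not_frequently_le_log (C := ε⁻¹)
  rw [not_frequently] at h
  filter_upwards [h, eventually_ge_atTop 1] with R hR hR1
  have h1 := log_nonneg hR1
  rw [norm_of_nonneg h1]
  have h2 : ε⁻¹ * log R ≤ characteristic f ⊤ R := (not_le.1 hR).le
  have h3 : 0 ≤ characteristic f ⊤ R := le_trans (by positivity) h2
  rw [norm_of_nonneg h3]
  rwa [inv_mul_le_iff₀ hε] at h2

theorem IsTranscendentalMeromorphic.tendsto_characteristic {f : ℂ → ℂ}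
    (hf : IsTranscendentalMeromorphic f) : Tendsto (characteristic f ⊤) atTop atTop := by
  have h := (Asymptotics.isLittleO_iff.1 hf.isLittleO_log_characteristic one_pos)
  refine tendsto_atTop_mono' _ ?_ tendsto_log_atTop
  filter_upwards [h, eventually_ge_atTop 1] with R hR hR1
  have h3 : 0 ≤ characteristic f ⊤ R :=
    (proximity_nonneg (f := f) (a := ⊤) R).trans (proximity_le_characteristic hR1)
  rw [norm_of_nonneg (log_nonneg hR1), norm_of_nonneg h3, one_mul] at hR
  exact hR

/-! ### Derivatives of meromorphic functions -/

theorem zero_le_meromorphicOrderAt_deriv {g : ℂ → ℂ} {z : ℂ} (hg : MeromorphicAt g z)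
    (h : 0 ≤ meromorphicOrderAt g z) : 0 ≤ meromorphicOrderAt (deriv g) z := by
  obtain ⟨u, hu, hgu⟩ := hg.meromorphicOrderAt_nonneg_iff.1 h
  exact hg.deriv.meromorphicOrderAt_nonneg_iff.2 ⟨deriv u, hu.deriv, hgu.nhdsNE_deriv⟩

theorem eventually_ne_zero_of_order_ne_top {g : ℂ → ℂ} (hg : Meromorphic g)
    (h : ∀ z, meromorphicOrderAt g z ≠ ⊤) : ∀ᶠ z in codiscrete ℂ, g z ≠ 0 :=
  eventually_codiscrete_iff.2 fun z ↦
    (meromorphicOrderAt_ne_top_iff_eventually_ne_zero (hg z)).1 (h z)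

theorem meromorphicOrderAt_ne_top_of_not_eventuallyEq {g : ℂ → ℂ} (hg : Meromorphic g)
    (h : ¬ g =ᶠ[codiscrete ℂ] fun _ ↦ 0) (z : ℂ) : meromorphicOrderAt g z ≠ ⊤ :=
  fun hz ↦ h (eventuallyEq_zero_of_meromorphicOrderAt_eq_top hg hz)

theorem eventually_analyticAt {g : ℂ → ℂ} (hg : Meromorphic g) :
    ∀ᶠ z in codiscrete ℂ, AnalyticAt ℂ g z :=
  eventually_codiscrete_iff.2 fun z ↦ (hg z).eventually_analyticAt

/-- A meromorphic function with vanishing derivative is constant. -/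
theorem exists_eventuallyEq_const_of_deriv {g : ℂ → ℂ} (hg : Meromorphic g)
    (h : deriv g =ᶠ[codiscrete ℂ] fun _ ↦ 0) : ∃ c : ℂ, g =ᶠ[codiscrete ℂ] fun _ ↦ c := by
  have : (codiscrete ℂ).NeBot := by
    refine ⟨fun hbot ↦ ?_⟩
    have : ∀ᶠ _z in codiscrete ℂ, False := by rw [hbot]; exact eventually_bot
    exact (eventually_codiscrete_iff.1 this 0).exists.elim fun _ h ↦ h
  obtain ⟨z₀, hz₀⟩ := (eventually_analyticAt hg).exists
  set u : ℂ → ℂ := fun z ↦ g z - g z₀ with hu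
  have hum : Meromorphic u := by fun_prop
  have hua : AnalyticAt ℂ u z₀ := by fun_prop
  have hud : deriv u = deriv g := by ext z; simp [hu]
  have htop : meromorphicOrderAt u z₀ = ⊤ := by
    by_contra hne
    obtain ⟨n, hn⟩ := WithTop.ne_top_iff_exists.1 hne
    have hpos : 0 < meromorphicOrderAt u z₀ := by
      refine (tendsto_zero_iff_meromorphicOrderAt_pos (hum z₀)).1 ?_
      have := hua.continuousAt.tendsto
      simp only [hu, sub_self] at this ⊢
      exact this.mono_left nhdsWithin_le_nhds
    have hn0 : n ≠ 0 := by
      rintro rfl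
      rw [← hn] at hpos
      exact absurd hpos (by simp)
    have h1 := meromorphicOrderAt_deriv_eq_sub_one (n := n) (by exact_mod_cast hn0) hn.symm
    rw [hud, meromorphicOrderAt_eq_top_iff.2 (eventually_codiscrete_iff.1 h z₀)] at h1
    exact WithTop.top_ne_coe h1
  refine ⟨g z₀, ?_⟩
  filter_upwards [eventuallyEq_zero_of_meromorphicOrderAt_eq_top hum htop] with z hz
  exact sub_eq_zero.1 hz

theorem exists_polynomial_derivative_eq (P : ℂ[X]) :
    ∃ A : ℂ[X], Polynomial.derivative A = P := by
  induction P using Polynomial.induction_on' with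
  | add p q hp hq =>
    obtain ⟨A, rfl⟩ := hp
    obtain ⟨B, rfl⟩ := hq
    exact ⟨A + B, Polynomial.derivative_add⟩
  | monomial n a =>
    refine ⟨Polynomial.monomial (n + 1) (a / (n + 1)), ?_⟩
    rw [Polynomial.derivative_monomial]
    have : (n : ℂ) + 1 ≠ 0 := Nat.cast_add_one_ne_zero n
    simp [div_mul_cancel₀ _ this]

theorem exists_polynomial_of_iterate_deriv (n : ℕ) : ∀ {g : ℂ → ℂ}, Meromorphic g →
    (∃ P : ℂ[X], deriv^[n] g =ᶠ[codiscrete ℂ] fun z ↦ P.eval z) →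
    ∃ P : ℂ[X], g =ᶠ[codiscrete ℂ] fun z ↦ P.eval z := by
  induction n with
  | zero => exact fun _ h ↦ h
  | succ n ih =>
    intro g hg h
    rw [Function.iterate_succ] at h
    obtain ⟨P, hP⟩ := ih hg.deriv h
    obtain ⟨A, rfl⟩ := exists_polynomial_derivative_eq P
    have hA : Meromorphic fun z ↦ A.eval z := fun z ↦ A.differentiable.analyticAt z |>.meromorphicAt
    obtain ⟨c, hc⟩ := exists_eventuallyEq_const_of_deriv (g := fun z ↦ g z - A.eval z)
      (hg.fun_sub hA) (by
        filter_upwards [hP, eventually_analyticAt hg] with z hz hza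
        rw [deriv_fun_sub hza.differentiableAt A.differentiable.differentiableAt, hz,
          Polynomial.deriv, sub_self])
    refine ⟨A + Polynomial.C c, ?_⟩
    filter_upwards [hc] with z hz
    rw [Polynomial.eval_add, Polynomial.eval_C, ← hz]
    ring

/-- No derivative of a transcendental function vanishes identically, as `f` would be a polynomial.
-/
theorem IsTranscendentalMeromorphic.order_iterate_deriv_ne_top {f : ℂ → ℂ}
    (hf : IsTranscendentalMeromorphic f) (n : ℕ) (z : ℂ) :
    meromorphicOrderAt (deriv^[n] f) z ≠ ⊤ := by
  intro h
  obtain ⟨P, hP⟩ := exists_polynomial_of_iterate_deriv n hf.1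
    ⟨0, by simpa using eventuallyEq_zero_of_meromorphicOrderAt_eq_top hf.1.iterated_deriv h⟩
  exact hf.2 ⟨P, 1, one_ne_zero, by simpa using hP⟩

/-! ### Error terms -/

theorem isErrorTerm_of_isLittleO {f : ℂ → ℂ} {S : ℝ → ℝ} {E : Set ℝ} (hE : volume E < ⊤)
    (h : S =o[atTop ⊓ 𝓟 Eᶜ] (characteristic f ⊤)) : IsErrorTerm f S := by
  refine ⟨E ∩ Ioi 0, inter_subset_right, (measure_mono inter_subset_left).trans_lt hE,
    h.mono ?_⟩
  refine le_inf inf_le_left ?_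
  rw [le_principal_iff, mem_inf_principal]
  filter_upwards [eventually_gt_atTop 0] with r hr hr' hrE
  exact hr' ⟨hrE, hr⟩

theorem IsErrorTerm.add {f : ℂ → ℂ} {S S' : ℝ → ℝ} (h : IsErrorTerm f S) (h' : IsErrorTerm f S') :
    IsErrorTerm f (S + S') := by
  obtain ⟨E, -, hE, hS⟩ := h
  obtain ⟨E', -, hE', hS'⟩ := h'
  refine isErrorTerm_of_isLittleO (E := E ∪ E')
    ((measure_union_le _ _).trans_lt (ENNReal.add_lt_top.2 ⟨hE, hE'⟩)) ?_
  refine (hS.mono ?_).add (hS'.mono ?_)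
  · exact inf_le_inf_left _ (principal_mono.2 (compl_subset_compl.2 subset_union_left))
  · exact inf_le_inf_left _ (principal_mono.2 (compl_subset_compl.2 subset_union_right))

theorem IsErrorTerm.const_mul {f : ℂ → ℂ} {S : ℝ → ℝ} (h : IsErrorTerm f S) (c : ℝ) :
    IsErrorTerm f (fun r ↦ c * S r) := by
  obtain ⟨E, hE0, hE, hS⟩ := h
  exact ⟨E, hE0, hE, hS.const_mul_left c⟩

/-- A function dominated by an error term, for `r ≥ 1` outside a set of finite measure, is an error
term. -/
theorem IsErrorTerm.of_abs_le {f : ℂ → ℂ} {S S' : ℝ → ℝ} {E : Set ℝ} (hE : volume E < ⊤)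
    (h : IsErrorTerm f S) (h' : ∀ r, 1 ≤ r → r ∉ E → |S' r| ≤ S r) : IsErrorTerm f S' := by
  obtain ⟨E', -, hE', hS⟩ := h
  refine isErrorTerm_of_isLittleO (E := E' ∪ E)
    ((measure_union_le _ _).trans_lt (ENNReal.add_lt_top.2 ⟨hE', hE⟩)) ?_
  refine Asymptotics.IsBigO.trans_isLittleO (g := S) ?_ (hS.mono ?_)
  · refine Asymptotics.IsBigO.of_bound 1 ?_
    rw [eventually_inf_principal]
    filter_upwards [eventually_ge_atTop 1] with r hr hr'
    rw [one_mul, Real.norm_eq_abs]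
    exact (h' r hr fun hrE ↦ hr' (Or.inr hrE)).trans (le_abs_self _)
  · exact inf_le_inf_left _ (principal_mono.2 (compl_subset_compl.2 subset_union_left))

theorem IsErrorTerm.of_abs_le' {f : ℂ → ℂ} {S S' : ℝ → ℝ}
    (h : IsErrorTerm f S) (h' : ∀ r, 1 ≤ r → |S' r| ≤ S r) : IsErrorTerm f S' :=
  h.of_abs_le (E := ∅) (by simp) fun r hr _ ↦ h' r hr

theorem isErrorTerm_const {f : ℂ → ℂ} (hf : IsTranscendentalMeromorphic f) (c : ℝ) :
    IsErrorTerm f (fun _ ↦ c) := by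
  refine isErrorTerm_of_isLittleO (E := ∅) (by simp) (Asymptotics.IsLittleO.mono ?_ inf_le_left)
  refine Asymptotics.isLittleO_const_left.2 (Or.inr ?_)
  exact tendsto_norm_atTop_atTop.comp hf.tendsto_characteristic

theorem isErrorTerm_log_add_one {f : ℂ → ℂ} (hf : IsTranscendentalMeromorphic f) :
    IsErrorTerm f (fun r ↦ log (r + 1)) := by
  have h : IsErrorTerm f log := isErrorTerm_of_isLittleO (E := ∅) (by simp)
    (hf.isLittleO_log_characteristic.mono inf_le_left)
  refine ((isErrorTerm_const hf (log 2)).add h).of_abs_le' fun r hr ↦ ?_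
  rw [abs_of_nonneg (log_nonneg (by linarith)), Pi.add_apply, ← log_mul (by norm_num) (by linarith)]
  exact log_le_log (by linarith) (by linarith)

theorem isErrorTerm_log_max_characteristic {f : ℂ → ℂ} (hf : IsTranscendentalMeromorphic f) :
    IsErrorTerm f (fun r ↦ log (max 1 (characteristic f ⊤ r))) := by
  refine isErrorTerm_of_isLittleO (E := ∅) (by simp) (Asymptotics.IsLittleO.mono ?_ inf_le_left)
  refine (isLittleO_log_id_atTop.comp_tendsto hf.tendsto_characteristic).congr' ?_ EventuallyEq.rfl
  filter_upwards [hf.tendsto_characteristic.eventually_ge_atTop 1] with r hr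
  rw [max_eq_right hr, Function.comp_apply]

/-! ### Functions dominated by `f` -/

/-- A meromorphic function `g`, not identically zero, with `T(r, g) = O(T(r, f)) + S(r, f)`. The
bound is required for all `r ≥ 1`: the exceptional set is hidden in the error term `S`. -/
def IsDominated (f g : ℂ → ℂ) : Prop :=
  Meromorphic g ∧ (∀ z, meromorphicOrderAt g z ≠ ⊤) ∧
    ∃ C : ℝ, 0 ≤ C ∧ ∃ S : ℝ → ℝ, IsErrorTerm f S ∧
      ∀ r, 1 ≤ r → characteristic g ⊤ r ≤ C * characteristic f ⊤ r + S r

theorem IsErrorTerm.exists_abs_le {f : ℂ → ℂ} {S : ℝ → ℝ} (h : IsErrorTerm f S) :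
    ∃ E : Set ℝ, volume E < ⊤ ∧ ∀ r, 1 ≤ r → r ∉ E → |S r| ≤ characteristic f ⊤ r := by
  obtain ⟨E, -, hE, hS⟩ := h
  have h1 := (Asymptotics.isLittleO_iff.1 hS) one_pos
  rw [eventually_inf_principal] at h1
  obtain ⟨r₀, hr₀⟩ := eventually_atTop.1 h1
  refine ⟨E ∪ Icc 0 r₀, (measure_union_le _ _).trans_lt (ENNReal.add_lt_top.2 ⟨hE, by simp⟩),
    fun r hr hrE ↦ ?_⟩
  have hr0 : r₀ ≤ r := by
    by_contra! h
    exact hrE (Or.inr ⟨by linarith, h.le⟩)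
  have := hr₀ r hr0 fun h ↦ hrE (Or.inl h)
  rwa [one_mul, norm_eq_abs, norm_of_nonneg (characteristic_nonneg hr)] at this

theorem characteristic_apply (f : ℂ → ℂ) (r : ℝ) :
    characteristic f ⊤ r = proximity f ⊤ r + logCounting f ⊤ r := rfl

namespace IsDominated

variable {f g h : ℂ → ℂ}

theorem self (hf : IsTranscendentalMeromorphic f) : IsDominated f f :=
  ⟨hf.1, hf.order_ne_top, 1, zero_le_one, _, isErrorTerm_const hf 0, fun r _ ↦ by simp⟩

theorem mul (hg : IsDominated f g) (hh : IsDominated f h) : IsDominated f (g * h) := by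
  obtain ⟨hgm, hg0, C, hC, S, hS, hT⟩ := hg
  obtain ⟨hhm, hh0, C', hC', S', hS', hT'⟩ := hh
  refine ⟨hgm.mul hhm, fun z ↦ ?_, C + C', by positivity, _, hS.add hS', fun r hr ↦ ?_⟩
  · rw [meromorphicOrderAt_mul (hgm z) (hhm z)]
    exact WithTop.add_ne_top.2 ⟨hg0 z, hh0 z⟩
  · refine (characteristic_mul_top_le hr hgm hg0 hhm hh0).trans ?_
    simp only [Pi.add_apply]
    linarith [hT r hr, hT' r hr]

theorem const (hf : IsTranscendentalMeromorphic f) {c : ℂ} (hc : c ≠ 0) :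
    IsDominated f (fun _ ↦ c) := by
  refine ⟨.const c, fun z ↦ ?_, 0, le_rfl, _, isErrorTerm_const hf (log⁺ ‖c‖), fun r _ ↦ ?_⟩
  · classical
    simp [meromorphicOrderAt_const, hc]
  · rw [characteristic_apply, proximity_const]
    simp

theorem one (hf : IsTranscendentalMeromorphic f) : IsDominated f 1 :=
  const hf one_ne_zero

theorem pow (hf : IsTranscendentalMeromorphic f) (hg : IsDominated f g) (n : ℕ) :
    IsDominated f (g ^ n) := by
  induction n with
  | zero => simpa using one hf
  | succ n ih => rw [pow_succ]; exact ih.mul hg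

theorem prod (hf : IsTranscendentalMeromorphic f) {ι : Type*} {s : Finset ι} {u : ι → ℂ → ℂ}
    (hu : ∀ i ∈ s, IsDominated f (u i)) : IsDominated f (∏ i ∈ s, u i) :=
  Finset.prod_induction _ _ (fun _ _ ↦ mul) (one hf) hu

theorem inv (hf : IsTranscendentalMeromorphic f) (hg : IsDominated f g) :
    IsDominated f g⁻¹ := by
  obtain ⟨hgm, hg0, C, hC, S, hS, hT⟩ := hg
  obtain ⟨c, -, hc⟩ := exists_characteristic_inv_le hgm
  refine ⟨hgm.inv, fun z ↦ ?_, C, hC, _, hS.add (isErrorTerm_const hf c), fun r hr ↦ ?_⟩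
  · rw [meromorphicOrderAt_inv]
    have := hg0 z
    lift meromorphicOrderAt g z to ℤ using this with n
    exact WithTop.coe_ne_top
  · simp only [Pi.add_apply]
    linarith [hT r hr, hc r]

theorem of_isSmallFunction (hg : IsSmallFunction f g) : IsDominated f g :=
  ⟨hg.1, meromorphicOrderAt_ne_top_of_not_eventuallyEq hg.1 hg.2.1, 0, le_rfl, _, hg.2.2,
    fun r _ ↦ by simp⟩

theorem sub_one (hf : IsTranscendentalMeromorphic f) (hg : IsDominated f g)
    (h0 : ¬ g =ᶠ[codiscrete ℂ] fun _ ↦ 1) : IsDominated f (fun z ↦ g z - 1) := by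
  obtain ⟨hgm, -, C, hC, S, hS, hT⟩ := hg
  have hm : Meromorphic fun z ↦ g z - 1 := by fun_prop
  refine ⟨hm, meromorphicOrderAt_ne_top_of_not_eventuallyEq hm fun h ↦ h0 ?_, C, hC, _,
    hS.add (isErrorTerm_const hf (log 2)), fun r hr ↦ ?_⟩
  · filter_upwards [h] with z hz using sub_eq_zero.1 hz
  · have e : (fun z ↦ g z - 1) = g + fun _ ↦ (-1 : ℂ) := by ext z; simp [sub_eq_add_neg]
    rw [e]
    refine (characteristic_add_top_le hgm (.const _) hr).trans ?_
    have : characteristic (fun _ : ℂ ↦ (-1 : ℂ)) ⊤ r = 0 := by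
      rw [characteristic_apply, proximity_const]
      simp
    rw [this, Pi.add_apply]
    linarith [hT r hr]

/-- The lemma on the logarithmic derivative, relative to the comparison function `f`. -/
theorem isErrorTerm_proximity_logDeriv (hf : IsTranscendentalMeromorphic f)
    (hg : IsDominated f g) : IsErrorTerm f (proximity (logDeriv g) ⊤) := by
  obtain ⟨hgm, hg0, C, hC, S, hS, hT⟩ := hg
  obtain ⟨E, hE, hSE⟩ := hS.exists_abs_le
  obtain ⟨A, hA, E', hE', hLE⟩ := exists_proximity_logDeriv_le hgm hg0
  have hbound : IsErrorTerm f (fun r ↦ A * (1 + log (C + 1) + log (r + 1)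
      + log (max 1 (characteristic f ⊤ r)))) :=
    (((isErrorTerm_const hf _).add (isErrorTerm_log_add_one hf)).add
      (isErrorTerm_log_max_characteristic hf)).const_mul A
  refine hbound.of_abs_le (E := E ∪ E')
    ((measure_union_le _ _).trans_lt (ENNReal.add_lt_top.2 ⟨hE, hE'⟩)) fun r hr hrE ↦ ?_
  rw [abs_of_nonneg (proximity_nonneg (f := logDeriv g) (a := ⊤) r)]
  refine (hLE r hr fun h ↦ hrE (Or.inr h)).trans (mul_le_mul_of_nonneg_left ?_ hA)
  have h1 : characteristic g ⊤ r ≤ (C + 1) * max 1 (characteristic f ⊤ r) := by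
    have a1 := hT r hr
    have a2 := (abs_le.1 (hSE r hr fun h ↦ hrE (Or.inl h))).2
    have a3 : characteristic f ⊤ r ≤ max 1 (characteristic f ⊤ r) := le_max_right _ _
    have a4 := mul_le_mul_of_nonneg_left a3 (by linarith : 0 ≤ C + 1)
    linarith
  have h2 : max 1 (characteristic g ⊤ r) ≤ (C + 1) * max 1 (characteristic f ⊤ r) :=
    max_le (one_le_mul_of_one_le_of_one_le (by linarith) (le_max_left _ _)) h1
  have h3 := log_le_log (by positivity) h2
  rw [log_mul (by positivity) (by positivity)] at h3
  linarith

/-- `m(r, g') ≤ m(r, g) + m(r, g' / g)` and `N(r, g') ≤ 2 N(r, g)`, since a pole of order `n` of `g`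
is a pole of order `n + 1 ≤ 2 n` of `g'`. -/
theorem deriv (hf : IsTranscendentalMeromorphic f) (hg : IsDominated f g)
    (h0 : ∀ z, meromorphicOrderAt (deriv g) z ≠ ⊤) : IsDominated f (deriv g) := by
  have hL := hg.isErrorTerm_proximity_logDeriv hf
  obtain ⟨hgm, hg0, C, hC, S, hS, hT⟩ := hg
  refine ⟨hgm.deriv, h0, 2 * C, by positivity, _, (hS.const_mul 2).add hL, fun r hr ↦ ?_⟩
  have hm : proximity (_root_.deriv g) ⊤ r ≤ proximity g ⊤ r + proximity (logDeriv g) ⊤ r := by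
    have e : _root_.deriv g =ᶠ[codiscrete ℂ] g * logDeriv g := by
      filter_upwards [eventually_ne_zero_of_order_ne_top hgm hg0] with z hz
      rw [Pi.mul_apply, logDeriv_apply, mul_div_cancel₀ _ hz]
    rw [proximity_congr_codiscrete e (by linarith)]
    exact proximity_mul_top_le hgm hgm.logDeriv r
  have hN : logCounting (_root_.deriv g) ⊤ r ≤ 2 * logCounting g ⊤ r := by
    have hle : (divisor (_root_.deriv g) univ)⁻ ≤ (divisor g univ)⁻ + (divisor g univ)⁻ := by
      intro z
      rw [locallyFinsuppWithin.coe_add, Pi.add_apply, locallyFinsuppWithin.negPart_apply,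
        locallyFinsuppWithin.negPart_apply, divisor_apply hgm.deriv.meromorphicOn (mem_univ z),
        divisor_apply hgm.meromorphicOn (mem_univ z)]
      by_cases hz : 0 ≤ meromorphicOrderAt g z
      · have := zero_le_meromorphicOrderAt_deriv (hgm z) hz
        rw [negPart_eq_zero.2 (WithTop.untop₀_nonneg.2 this)]
        positivity
      · obtain ⟨n, hn⟩ := WithTop.ne_top_iff_exists.1 (hg0 z)
        rw [← hn] at hz
        have hn0 : n < 0 := by
          by_contra! h
          exact hz (by exact_mod_cast h)
        rw [meromorphicOrderAt_deriv_eq_sub_one (n := n) (by exact_mod_cast hn0.ne) hn.symm, ← hn,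
          WithTop.untop₀_coe, WithTop.untop₀_coe, negPart_eq_neg.2 hn0.le,
          negPart_eq_neg.2 (by omega : n - 1 ≤ 0)]
        have : -(n - 1) ≤ -n + -n := by omega
        exact this
    have := locallyFinsuppWithin.logCounting_le hle hr
    rw [map_add, Pi.add_apply, ← logCounting_top, ← logCounting_top] at this
    linarith
  have hp := proximity_nonneg (f := g) (a := ⊤) r
  have := hT r hr
  simp only [characteristic_apply, Pi.add_apply, Pi.zero_apply] at *
  linarith

theorem iterate_deriv (hf : IsTranscendentalMeromorphic f) (n : ℕ) :
    IsDominated f (_root_.deriv^[n] f) := by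
  induction n with
  | zero => exact self hf
  | succ n ih =>
    rw [Function.iterate_succ_apply']
    refine ih.deriv hf fun z ↦ ?_
    rw [← Function.iterate_succ_apply' (f := _root_.deriv)]
    exact hf.order_iterate_deriv_ne_top _ z

end IsDominated

/-- A meromorphic function whose proximity function at infinity is an error term of `f`. -/
def HasSmallProximity (f g : ℂ → ℂ) : Prop :=
  Meromorphic g ∧ IsErrorTerm f (proximity g ⊤)

namespace HasSmallProximity

variable {f g h : ℂ → ℂ}

theorem of_le {S : ℝ → ℝ} (hg : Meromorphic g) (hS : IsErrorTerm f S)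
    (hle : ∀ r, 1 ≤ r → proximity g ⊤ r ≤ S r) : HasSmallProximity f g :=
  ⟨hg, hS.of_abs_le' fun r hr ↦ by
    rw [abs_of_nonneg (proximity_nonneg (f := g) (a := ⊤) r)]
    exact hle r hr⟩

theorem mul (hg : HasSmallProximity f g) (hh : HasSmallProximity f h) :
    HasSmallProximity f (g * h) :=
  of_le (hg.1.mul hh.1) (hg.2.add hh.2) fun r _ ↦ proximity_mul_top_le hg.1 hh.1 r

theorem const (hf : IsTranscendentalMeromorphic f) (c : ℂ) : HasSmallProximity f (fun _ ↦ c) :=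
  of_le (.const c) (isErrorTerm_const hf (log⁺ ‖c‖)) fun r _ ↦ by simp

theorem one (hf : IsTranscendentalMeromorphic f) : HasSmallProximity f 1 := const hf 1

theorem pow (hf : IsTranscendentalMeromorphic f) (hg : HasSmallProximity f g) (n : ℕ) :
    HasSmallProximity f (g ^ n) := by
  induction n with
  | zero => simpa using one hf
  | succ n ih => rw [pow_succ]; exact ih.mul hg

theorem prod (hf : IsTranscendentalMeromorphic f) {ι : Type*} {s : Finset ι} {u : ι → ℂ → ℂ}
    (hu : ∀ i ∈ s, HasSmallProximity f (u i)) : HasSmallProximity f (∏ i ∈ s, u i) :=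
  Finset.prod_induction _ _ (fun _ _ ↦ mul) (one hf) hu

theorem logDeriv (hf : IsTranscendentalMeromorphic f) (hg : IsDominated f g) :
    HasSmallProximity f (logDeriv g) :=
  ⟨hg.1.logDeriv, hg.isErrorTerm_proximity_logDeriv hf⟩

theorem of_isSmallFunction (hg : IsSmallFunction f g) : HasSmallProximity f g :=
  of_le hg.1 hg.2.2 fun _ hr ↦ proximity_le_characteristic hr

theorem inv_of_isSmallFunction (hf : IsTranscendentalMeromorphic f) (hg : IsSmallFunction f g) :
    HasSmallProximity f g⁻¹ := by
  obtain ⟨c, -, hc⟩ := exists_characteristic_inv_le hg.1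
  exact of_le hg.1.inv (hg.2.2.add (isErrorTerm_const hf c)) fun r hr ↦
    (proximity_le_characteristic hr).trans (hc r)

end HasSmallProximity

/-! ### The proximity function of `1 / f` -/

theorem eventually_iterate_deriv_eq_mul_prod {f : ℂ → ℂ} (hf : IsTranscendentalMeromorphic f)
    (n : ℕ) : ∀ᶠ z in codiscrete ℂ,
      deriv^[n] f z = f z * ∏ j ∈ Finset.range n, logDeriv (deriv^[j] f) z := by
  induction n with
  | zero => simp
  | succ n ih =>
    filter_upwards [ih, eventually_ne_zero_of_order_ne_top hf.1.iterated_deriv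
      (hf.order_iterate_deriv_ne_top n)] with z hz hz0
    rw [Finset.prod_range_succ, ← mul_assoc, ← hz, logDeriv_apply, mul_div_cancel₀ _ hz0,
      Function.iterate_succ_apply']

/-- The product of the derivatives of `f` is `f ^ μ` times a product of logarithmic derivatives. -/
theorem prod_iterate_deriv_eventuallyEq {f : ℂ → ℂ} (hf : IsTranscendentalMeromorphic f)
    (k : ℕ) (q : ℕ → ℕ) :
    (∏ i ∈ Finset.range (k + 1), (deriv^[i] f) ^ q i) =ᶠ[codiscrete ℂ]
      (∏ i ∈ Finset.range (k + 1), (∏ j ∈ Finset.range i, logDeriv (deriv^[j] f)) ^ q i)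
        * f ^ monomialDegree k q := by
  filter_upwards [(eventually_all_finset (Finset.range (k + 1))).2 fun i _ ↦
    eventually_iterate_deriv_eq_mul_prod hf i] with z hz
  simp only [Finset.prod_apply, Pi.pow_apply, Pi.mul_apply, monomialDegree]
  rw [← Finset.prod_pow_eq_pow_sum, ← Finset.prod_mul_distrib]
  refine Finset.prod_congr rfl fun i hi ↦ ?_
  rw [hz i hi, mul_pow, mul_comm]

/-- If `F = W f ^ μ` and `L = (F - 1)' / (F - 1)`, then `f ^ (-μ) = W (1 - (F' / F) L⁻¹)`. Jensen's
formula for `L` turns this identity into a bound for `m(r, 1 / f)`. -/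
theorem exists_proximity_inv_add_logCounting_le {f F W : ℂ → ℂ} {μ : ℕ}
    (hf : IsTranscendentalMeromorphic f) (hF : IsDominated f F) (hW : HasSmallProximity f W)
    (hFW : F =ᶠ[codiscrete ℂ] W * f ^ μ) (hd : ¬ deriv F =ᶠ[codiscrete ℂ] fun _ ↦ 0)
    (h1 : ¬ F =ᶠ[codiscrete ℂ] fun _ ↦ 1) :
    ∃ S : ℝ → ℝ, IsErrorTerm f S ∧ ∀ r, 1 ≤ r → μ * proximity f⁻¹ ⊤ r
      + (divisor (logDeriv fun z ↦ F z - 1) univ).logCounting r ≤ S r := by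
  have hG := hF.sub_one hf h1
  set G : ℂ → ℂ := fun z ↦ F z - 1 with hGdef
  set L := logDeriv G with hLdef
  have hL : Meromorphic L := hG.1.logDeriv
  have hGd : deriv G = deriv F := by ext z; simp [hGdef]
  have hid : f⁻¹ ^ μ =ᶠ[codiscrete ℂ]
      W * ((fun _ ↦ 1) + (fun _ ↦ (-1 : ℂ)) * (logDeriv F * L⁻¹)) := by
    filter_upwards [eventually_ne_zero_of_order_ne_top hf.1 hf.order_ne_top,
      eventually_ne_zero_of_order_ne_top hF.1 hF.2.1,
      eventually_ne_zero_of_order_ne_top hG.1 hG.2.1,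
      eventually_ne_zero_of_order_ne_top hF.1.deriv
        (meromorphicOrderAt_ne_top_of_not_eventuallyEq hF.1.deriv hd), hFW] with z z1 z2 z3 z4 z5
    simp only [Pi.mul_apply, Pi.pow_apply, Pi.inv_apply, Pi.add_apply] at z5 ⊢
    have e : L z = deriv F z / (F z - 1) := by rw [hLdef, logDeriv_apply, hGd]
    have z3' : F z - 1 ≠ 0 := z3
    have hpow : f z ^ μ ≠ 0 := pow_ne_zero _ z1
    have key : 1 + -1 * (logDeriv F z * (L z)⁻¹) = (F z)⁻¹ := by
      rw [e, logDeriv_apply]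
      field_simp
      ring
    have hW0 : W z ≠ 0 := fun h ↦ z2 (by rw [z5, h, zero_mul])
    rw [key, z5, mul_inv, inv_pow, ← mul_assoc, mul_inv_cancel₀ hW0, one_mul]
  set κ := log ‖meromorphicTrailingCoeffAt L 0‖
  refine ⟨_, ((hW.2.add (hF.isErrorTerm_proximity_logDeriv hf)).add
    (hG.isErrorTerm_proximity_logDeriv hf)).add (isErrorTerm_const hf (log 2 - κ)),
    fun r hr ↦ ?_⟩
  have hr0 : r ≠ 0 := by linarith
  have hLF := hF.1.logDeriv
  have hY : Meromorphic ((fun _ ↦ (-1 : ℂ)) * (logDeriv F * L⁻¹)) :=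
    (Meromorphic.const _).mul (hLF.mul hL.inv)
  have e1 : proximity (f⁻¹ ^ μ) ⊤ r = μ * proximity f⁻¹ ⊤ r := by
    rw [proximity_pow_top]
    simp
  have e2 := proximity_mul_top_le hW.1 ((Meromorphic.const (1 : ℂ)).add hY) r
  have e3 := proximity_add_top_le (Meromorphic.const (1 : ℂ)) hY r
  have e4 := proximity_mul_top_le (Meromorphic.const (-1 : ℂ)) (hLF.mul hL.inv) r
  have e5 := proximity_mul_top_le hLF hL.inv r
  have e6 := congrFun (proximity_sub_proximity_inv_eq_circleAverage hL) r
  have e7 := locallyFinsuppWithin.logCounting_divisor_eq_circleAverage_sub_const hL hr0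
  rw [proximity_congr_codiscrete hid hr0] at e1
  simp only [Pi.add_apply, Pi.sub_apply, proximity_const, norm_neg, norm_one, posLog_one]
    at e2 e3 e4 e5 e6 ⊢
  linarith

theorem exists_proximity_inv_le_of_const {f W : ℂ → ℂ} {μ : ℕ} {c : ℂ} (hc : c ≠ 0)
    (hf : IsTranscendentalMeromorphic f) (hW : HasSmallProximity f W)
    (hFW : W * f ^ μ =ᶠ[codiscrete ℂ] fun _ ↦ c) :
    ∃ S : ℝ → ℝ, IsErrorTerm f S ∧ ∀ r, 1 ≤ r → μ * proximity f⁻¹ ⊤ r ≤ S r := by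
  refine ⟨_, (hW.mul (.const hf c⁻¹)).2, fun r hr ↦ ?_⟩
  have hid : f⁻¹ ^ μ =ᶠ[codiscrete ℂ] W * fun _ ↦ c⁻¹ := by
    filter_upwards [hFW, eventually_ne_zero_of_order_ne_top hf.1 hf.order_ne_top] with z hz hz0
    simp only [Pi.mul_apply, Pi.pow_apply, Pi.inv_apply] at hz ⊢
    rw [← hz, mul_inv, ← mul_assoc, inv_pow, mul_inv_cancel₀, one_mul]
    rintro h
    exact hc (by rw [← hz, h, zero_mul])
  rw [← proximity_congr_codiscrete hid (by linarith), proximity_pow_top]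
  simp

/-! ### Orders -/

theorem natCast_mul_nonneg (n : ℕ) {x : WithTop ℤ} (hx : 0 ≤ x) : 0 ≤ (n : WithTop ℤ) * x := by
  cases x with
  | top =>
    rcases Nat.eq_zero_or_pos n with rfl | h
    · simp
    · rw [WithTop.mul_top (by exact_mod_cast h.ne')]
      exact le_top
  | coe x =>
    have : 0 ≤ x := by exact_mod_cast hx
    have : 0 ≤ (n : ℤ) * x := by positivity
    exact_mod_cast this

theorem meromorphicOrderAt_prod_iterate_deriv_ge {f : ℂ → ℂ} (hf : Meromorphic f) (k : ℕ)
    (q : ℕ → ℕ) {z : ℂ} (hz : 0 ≤ meromorphicOrderAt f z) :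
    q 0 * meromorphicOrderAt f z
      ≤ meromorphicOrderAt (∏ i ∈ Finset.range (k + 1), (deriv^[i] f) ^ q i) z := by
  have hnn : ∀ i, 0 ≤ meromorphicOrderAt (deriv^[i] f) z := by
    intro i
    induction i with
    | zero => exact hz
    | succ i ih =>
      rw [Function.iterate_succ_apply']
      exact zero_le_meromorphicOrderAt_deriv (hf.iterated_deriv z) ih
  rw [meromorphicOrderAt_prod fun i _ ↦ (hf.iterated_deriv z).pow _]
  have : ∀ i, meromorphicOrderAt ((deriv^[i] f) ^ q i) z
      = q i * meromorphicOrderAt (deriv^[i] f) z := fun i ↦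
    meromorphicOrderAt_pow (hf.iterated_deriv z)
  simp only [this]
  refine Finset.single_le_sum (f := fun i ↦ ((q i : ℕ) : WithTop ℤ) * meromorphicOrderAt (deriv^[i] f) z)
    (fun i _ ↦ natCast_mul_nonneg _ (hnn i)) (Finset.mem_range.2 (Nat.succ_pos k))

/-- The order of `(F - 1)' / (F - 1)` at a point where `F` has order `n`: it is `n - 1` at a zero of
`F`, and `-1` at a pole of `F` and at a zero of `F - 1`. It is nonnegative elsewhere. -/
theorem divisor_logDeriv_sub_one {F : ℂ → ℂ} (hF : Meromorphic F) {z : ℂ} {n : ℤ}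
    (hn : meromorphicOrderAt F z = n) (h1 : meromorphicOrderAt (fun w ↦ F w - 1) z ≠ ⊤) :
    (0 < n → divisor (logDeriv fun w ↦ F w - 1) univ z = n - 1) ∧
    (n < 0 → divisor (logDeriv fun w ↦ F w - 1) univ z = -1) ∧
    (n = 0 → meromorphicOrderAt (fun w ↦ F w - 1) z = 0 →
      0 ≤ divisor (logDeriv fun w ↦ F w - 1) univ z) ∧
    (n = 0 → meromorphicOrderAt (fun w ↦ F w - 1) z ≠ 0 →
      0 < meromorphicOrderAt (fun w ↦ F w - 1) z ∧
        divisor (logDeriv fun w ↦ F w - 1) univ z = -1) := by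
  classical
  set G : ℂ → ℂ := fun w ↦ F w - 1 with hG
  have hGm : Meromorphic G := by fun_prop
  have hG' : G = F + fun _ ↦ (-1 : ℂ) := by ext w; simp [hG, sub_eq_add_neg]
  have hc : meromorphicOrderAt (fun _ : ℂ ↦ (-1 : ℂ)) z = 0 := by simp [meromorphicOrderAt_const]
  rw [divisor_apply hGm.logDeriv.meromorphicOn (mem_univ z)]
  have hneg : meromorphicOrderAt G z ≠ 0 → (meromorphicOrderAt (logDeriv G) z).untop₀ = -1 := by
    intro h
    rw [meromorphicOrderAt_logDeriv_eq_neg_one (hGm z) h h1]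
    rfl
  refine ⟨fun h ↦ ?_, fun h ↦ ?_, fun h h' ↦ ?_, fun h h' ↦ ⟨?_, hneg h'⟩⟩
  · have hG0 : meromorphicOrderAt G z = 0 := by
      rw [hG', meromorphicOrderAt_add_of_ne (hF z) (.const _ _), hc, hn, min_eq_right]
      · exact_mod_cast h.le
      · rw [hc, hn]; exact_mod_cast h.ne'
    have hGd : deriv G = deriv F := by ext w; simp [hG]
    have : logDeriv G = deriv F / G := by rw [logDeriv, hGd]
    rw [this, meromorphicOrderAt_div (hF z).deriv (hGm z), hG0,
      meromorphicOrderAt_deriv_eq_sub_one (n := n) (by exact_mod_cast h.ne') hn, sub_zero]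
    rfl
  · refine hneg ?_
    rw [hG', meromorphicOrderAt_add_of_ne (hF z) (.const _ _), hc, hn, min_eq_left]
    · exact_mod_cast h.ne
    · exact_mod_cast h.le
    · rw [hc, hn]; exact_mod_cast h.ne
  · exact WithTop.untop₀_nonneg.2 (meromorphicOrderAt_logDeriv_nonneg (hGm z) h')
  · refine lt_of_le_of_ne ?_ h'.symm
    rw [hG']
    refine le_trans ?_ (meromorphicOrderAt_add (hF z) (.const _ _))
    rw [hc, hn, h]
    simp

theorem isErrorTerm_logCounting_zero_add_top {f g : ℂ → ℂ} (hf : IsTranscendentalMeromorphic f)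
    (hg : IsSmallFunction f g) : IsErrorTerm f (logCounting g 0 + logCounting g ⊤) := by
  obtain ⟨c, -, hc⟩ := exists_characteristic_inv_le hg.1
  refine ((hg.2.2.add hg.2.2).add (isErrorTerm_const hf c)).of_abs_le' fun r hr ↦ ?_
  have h1 := logCounting_nonneg (f := g) (e := 0) hr
  have h2 := logCounting_nonneg (f := g) (e := ⊤) hr
  have h3 := logCounting_le_characteristic (f := g⁻¹) (a := ⊤) r
  have h4 := logCounting_le_characteristic (f := g) (a := ⊤) r
  rw [logCounting_inv] at h3
  simp only [Pi.add_apply]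
  rw [abs_of_nonneg (by positivity)]
  linarith [hc r]

/-! ### Comparison of divisors -/

theorem reducedDivisor_apply (D : locallyFinsupp ℂ ℤ) (z : ℂ) :
    reducedDivisor D z = if 0 < D z then 1 else 0 := rfl

theorem reducedCountingZeros_nonneg (f : ℂ → ℂ) {r : ℝ} (hr : 1 ≤ r) :
    0 ≤ reducedCountingZeros f r := by
  refine locallyFinsuppWithin.logCounting_nonneg (fun z ↦ ?_) hr
  change (0 : ℤ) ≤ _
  rw [reducedDivisor_apply]
  split_ifs <;> simp

theorem reducedCountingPoles_nonneg (f : ℂ → ℂ) {r : ℝ} (hr : 1 ≤ r) :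
    0 ≤ reducedCountingPoles f r := by
  refine locallyFinsuppWithin.logCounting_nonneg (fun z ↦ ?_) hr
  change (0 : ℤ) ≤ _
  rw [reducedDivisor_apply]
  split_ifs <;> simp

theorem coe_divisor_eq {g : ℂ → ℂ} (hg : Meromorphic g) (z : ℂ)
    (h0 : meromorphicOrderAt g z ≠ ⊤) :
    meromorphicOrderAt g z = (divisor g univ z : ℤ) := by
  rw [divisor_apply hg.meromorphicOn (mem_univ z), WithTop.coe_untop₀_of_ne_top h0]

/-- The order of `F = a φ⁻¹ M₀` at a point: `ord F ≥ q₀ ord f + ord a - ord φ` unless `f` has a pole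
there. -/
theorem le_divisor_of_monomial {f a φ F : ℂ → ℂ} {k : ℕ} {q : ℕ → ℕ} (hf : Meromorphic f)
    (hf0 : ∀ z, meromorphicOrderAt f z ≠ ⊤)
    (ha : Meromorphic a) (ha0 : ∀ z, meromorphicOrderAt a z ≠ ⊤)
    (hφ : Meromorphic φ) (hφ0 : ∀ z, meromorphicOrderAt φ z ≠ ⊤)
    (hF0 : ∀ z, meromorphicOrderAt F z ≠ ⊤)
    (hF : F = a * φ⁻¹ * ∏ i ∈ Finset.range (k + 1), (deriv^[i] f) ^ q i) (z : ℂ)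
    (hz : 0 ≤ divisor f univ z) :
    divisor a univ z - divisor φ univ z + q 0 * divisor f univ z ≤ divisor F univ z := by
  have hM : Meromorphic (∏ i ∈ Finset.range (k + 1), (deriv^[i] f) ^ q i) :=
    Meromorphic.prod fun i _ ↦ hf.iterated_deriv.pow
  have hFm : Meromorphic F := hF ▸ (ha.mul hφ.inv).mul hM
  have h1 : meromorphicOrderAt F z = meromorphicOrderAt a z + -meromorphicOrderAt φ z
      + meromorphicOrderAt (∏ i ∈ Finset.range (k + 1), (deriv^[i] f) ^ q i) z := by
    rw [hF, meromorphicOrderAt_mul ((ha z).mul (hφ z).inv) (hM z),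
      meromorphicOrderAt_mul (ha z) (hφ z).inv, meromorphicOrderAt_inv]
  have hM0 : meromorphicOrderAt (∏ i ∈ Finset.range (k + 1), (deriv^[i] f) ^ q i) z ≠ ⊤ := by
    intro h
    rw [h, add_top] at h1
    exact hF0 z h1
  have h2 := meromorphicOrderAt_prod_iterate_deriv_ge hf k q (z := z) (by
    rw [coe_divisor_eq hf z (hf0 z)]
    exact_mod_cast hz)
  rw [coe_divisor_eq hM z hM0, coe_divisor_eq ha z (ha0 z), coe_divisor_eq hφ z (hφ0 z),
    coe_divisor_eq hFm z (hF0 z)] at h1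
  rw [coe_divisor_eq hM z hM0, coe_divisor_eq hf z (hf0 z)] at h2
  have h1' : divisor F univ z = divisor a univ z + -divisor φ univ z
      + divisor (∏ i ∈ Finset.range (k + 1), (deriv^[i] f) ^ q i) univ z := by exact_mod_cast h1
  have h2' : (q 0 : ℤ) * divisor f univ z
      ≤ divisor (∏ i ∈ Finset.range (k + 1), (deriv^[i] f) ^ q i) univ z := by exact_mod_cast h2
  linarith

/-- The inequality between divisors at a single point. The variables `p`, `α`, `β`, `ν`, `n`, `g`,
`l` stand for the orders of `f`, `a`, `φ`, `M[f] - φ`, `F`, `F - 1` and `(F - 1)' / (F - 1)`. -/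
theorem mul_posPart_sub_le {m : ℕ} {p α β ν n g l : ℤ} (hν : ν = β + g)
    (hpos : 0 < n → l = n - 1) (hneg : n < 0 → l = -1) (hzero : n = 0 → g = 0 → 0 ≤ l)
    (hone : n = 0 → g ≠ 0 → 0 < g ∧ l = -1) (hz : 0 ≤ p → α - β + m * p ≤ n) :
    m * p⁺ - l ≤ (if 0 < p⁻ then 1 else 0) + (if 0 < p⁺ then 1 else 0)
      + (if 0 < ν⁺ then 1 else 0) + (α⁺ + α⁻) + (β⁺ + β⁻) := by
  have ht1 : p ≤ 0 → (m : ℤ) * p⁺ = 0 := fun h ↦ by rw [posPart_eq_zero.2 h, mul_zero]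
  have ht2 : 0 ≤ p → (m : ℤ) * p⁺ = m * p := fun h ↦ by rw [posPart_eq_self.2 h]
  simp only [negPart_pos_iff, posPart_pos_iff, posPart_add_negPart]
  have hα1 := neg_abs_le α
  have hα2 := abs_nonneg α
  have hβ1 := le_abs_self β
  have hβ2 := neg_abs_le β
  generalize (m : ℤ) * p⁺ = t at *
  generalize (m : ℤ) * p = s at *
  generalize |α| = x at *
  generalize |β| = y at *
  split_ifs <;> omega

theorem nsmul_divisor_sub_le {f a φ F N : ℂ → ℂ} {m : ℕ}
    (hφ : Meromorphic φ) (hφ0 : ∀ z, meromorphicOrderAt φ z ≠ ⊤)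
    (hF : Meromorphic F) (hF0 : ∀ z, meromorphicOrderAt F z ≠ ⊤)
    (hG0 : ∀ z, meromorphicOrderAt (fun w ↦ F w - 1) z ≠ ⊤)
    (hN : N =ᶠ[codiscrete ℂ] φ * fun w ↦ F w - 1)
    (hord : ∀ z, 0 ≤ divisor f univ z →
      divisor a univ z - divisor φ univ z + m * divisor f univ z ≤ divisor F univ z) :
    m • (divisor f univ)⁺ - divisor (logDeriv fun w ↦ F w - 1) univ ≤
      reducedDivisor (divisor f univ)⁻ + reducedDivisor (divisor f univ)⁺
      + reducedDivisor (divisor N univ)⁺ + ((divisor a univ)⁺ + (divisor a univ)⁻)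
      + ((divisor φ univ)⁺ + (divisor φ univ)⁻) := by
  intro z
  have hG : Meromorphic fun w ↦ F w - 1 := by fun_prop
  have hNm : Meromorphic N := (hφ.mul hG).congr_codiscrete hN.symm
  have hNo : meromorphicOrderAt N z
      = meromorphicOrderAt φ z + meromorphicOrderAt (fun w ↦ F w - 1) z := by
    rw [meromorphicOrderAt_congr (eventually_codiscrete_iff.1 hN z),
      meromorphicOrderAt_mul (hφ z) (hG z)]
  have hN0 : meromorphicOrderAt N z ≠ ⊤ := by
    rw [hNo]
    exact WithTop.add_ne_top.2 ⟨hφ0 z, hG0 z⟩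
  rw [coe_divisor_eq hNm z hN0, coe_divisor_eq hφ z (hφ0 z), coe_divisor_eq hG z (hG0 z)] at hNo
  have hNo' : divisor N univ z = divisor φ univ z + divisor (fun w ↦ F w - 1) univ z := by
    exact_mod_cast hNo
  obtain ⟨c1, c2, c3, c4⟩ := divisor_logDeriv_sub_one hF (coe_divisor_eq hF z (hF0 z)) (hG0 z)
  rw [coe_divisor_eq hG z (hG0 z)] at c3 c4
  have hz := hord z
  have key := mul_posPart_sub_le (m := m) hNo' c1 c2 (fun h h' ↦ c3 h (by rw [h']; rfl))
    (fun h h' ↦ (c4 h (by exact_mod_cast h')).imp_left fun h ↦ by exact_mod_cast h) (hord z)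
  rw [← nsmul_eq_mul] at key
  exact key

/-- If `F` is constant, a zero of `f` must be compensated by a pole of `a` or a zero of `φ`. -/
theorem nsmul_posPart_divisor_le {f a φ : ℂ → ℂ} {m : ℕ}
    (hord : ∀ z, 0 ≤ divisor f univ z →
      divisor a univ z - divisor φ univ z + m * divisor f univ z ≤ 0) :
    m • (divisor f univ)⁺ ≤ ((divisor a univ)⁺ + (divisor a univ)⁻)
      + ((divisor φ univ)⁺ + (divisor φ univ)⁻) := by
  intro z
  have key : ∀ p α β : ℤ, (0 ≤ p → α - β + m * p ≤ 0) → m * p⁺ ≤ (α⁺ + α⁻) + (β⁺ + β⁻) := by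
    intro p α β h
    rw [posPart_add_negPart, posPart_add_negPart]
    have hα1 := neg_abs_le α
    have hα2 := abs_nonneg α
    have hβ1 := le_abs_self β
    have hβ2 := abs_nonneg β
    rcases le_total 0 p with hp | hp
    · rw [posPart_eq_self.2 hp]
      linarith [h hp]
    · rw [posPart_eq_zero.2 hp, mul_zero]
      linarith
  have := key _ _ _ (hord z)
  rw [← nsmul_eq_mul] at this
  exact this

/-- The estimate for `r ≥ 1`, with the weight term dropped. -/
theorem exists_isErrorTerm_le {f a φ : ℂ → ℂ} {k : ℕ} {q : ℕ → ℕ}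
    (hf : IsTranscendentalMeromorphic f) (ha : IsSmallFunction f a) (hφ : IsSmallFunction f φ) :
    ∃ S : ℝ → ℝ, IsErrorTerm f S ∧ ∀ r : ℝ, 1 ≤ r →
      (monomialDegree k q : ℝ) * characteristic f ⊤ r ≤ reducedCountingPoles f r
        + ((monomialDegree k q : ℝ) - (q 0 : ℝ)) * logCounting f 0 r + reducedCountingZeros f r
        + reducedCountingZeros (fun z ↦ diffMonomial a k q f z - φ z) r + S r := by
  set μ := monomialDegree k q with hμ
  set M := ∏ i ∈ Finset.range (k + 1), (deriv^[i] f) ^ q i with hM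
  set F := a * φ⁻¹ * M with hF
  set W := a * φ⁻¹ *
    ∏ i ∈ Finset.range (k + 1), (∏ j ∈ Finset.range i, logDeriv (deriv^[j] f)) ^ q i with hW
  set N : ℂ → ℂ := fun z ↦ diffMonomial a k q f z - φ z with hN
  have haD := IsDominated.of_isSmallFunction ha
  have hφD := IsDominated.of_isSmallFunction hφ
  have hFD : IsDominated f F := (haD.mul (hφD.inv hf)).mul
    (.prod hf fun i _ ↦ (IsDominated.iterate_deriv hf i).pow hf _)
  have hWS : HasSmallProximity f W :=
    ((HasSmallProximity.of_isSmallFunction ha).mul (.inv_of_isSmallFunction hf hφ)).mul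
      (.prod hf fun i _ ↦ (HasSmallProximity.prod hf fun j _ ↦
        .logDeriv hf (IsDominated.iterate_deriv hf j)).pow hf _)
  have hFW : F =ᶠ[codiscrete ℂ] W * f ^ μ := by
    rw [hW, mul_assoc]
    exact EventuallyEq.rfl.mul (prod_iterate_deriv_eventuallyEq hf k q)
  have hord := le_divisor_of_monomial (k := k) (q := q) hf.1 hf.order_ne_top ha.1 haD.2.1 hφ.1
    hφD.2.1 hFD.2.1 hF
  -- the first main theorem reduces the claim to a bound for the proximity function of `1 / f`
  obtain ⟨c, -, hc⟩ := exists_characteristic_inv_le (f := f⁻¹) hf.1.inv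
  have hT : ∀ r, μ * characteristic f ⊤ r
      ≤ μ * proximity f⁻¹ ⊤ r + μ * logCounting f 0 r + μ * c := fun r ↦ by
    have h := hc r
    rw [inv_inv, characteristic_apply f⁻¹, logCounting_inv] at h
    have := mul_le_mul_of_nonneg_left h (Nat.cast_nonneg (α := ℝ) μ)
    linarith
  have hSa := isErrorTerm_logCounting_zero_add_top hf ha
  have hSφ := isErrorTerm_logCounting_zero_add_top hf hφ
  have hSc := isErrorTerm_const hf (μ * c)
  by_cases hd : deriv F =ᶠ[codiscrete ℂ] fun _ ↦ 0
  · obtain ⟨b, hb⟩ := exists_eventuallyEq_const_of_deriv hFD.1 hd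
    have hb0 : b ≠ 0 := by
      rintro rfl
      exact hFD.2.1 0 (meromorphicOrderAt_eq_top_iff.2 (eventually_codiscrete_iff.1 hb 0))
    obtain ⟨S, hS, hSle⟩ := exists_proximity_inv_le_of_const hb0 hf hWS (hFW.symm.trans hb)
    have hdiv : ∀ z, divisor F univ z = 0 := fun z ↦ by
      classical
      rw [divisor_apply hFD.1.meromorphicOn (mem_univ z),
        meromorphicOrderAt_congr (eventually_codiscrete_iff.1 hb z), meromorphicOrderAt_const,
        if_neg hb0]
      rfl
    refine ⟨_, ((hS.add hSc).add hSa).add hSφ, fun r hr ↦ ?_⟩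
    have h1 := locallyFinsuppWithin.logCounting_le (nsmul_posPart_divisor_le (m := q 0)
      fun z hz ↦ (hord z hz).trans (hdiv z).le) hr
    simp only [map_add, map_nsmul, Pi.add_apply, Pi.smul_apply, ← logCounting_zero,
      ← logCounting_top] at h1 ⊢
    rw [nsmul_eq_mul] at h1
    have := reducedCountingPoles_nonneg f hr
    have := reducedCountingZeros_nonneg f hr
    have := reducedCountingZeros_nonneg N hr
    linarith [hSle r hr, hT r]
  · have h1 : ¬ F =ᶠ[codiscrete ℂ] fun _ ↦ 1 := fun h ↦ hd <| by
      have h' := hFD.1.meromorphicOn.deriv_eventuallyEq_codiscreteWithin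
        (Meromorphic.const (1 : ℂ)).meromorphicOn h
      rw [deriv_const'] at h'
      exact h'
    obtain ⟨S, hS, hSle⟩ := exists_proximity_inv_add_logCounting_le hf hFD hWS hFW hd h1
    have hNF : N =ᶠ[codiscrete ℂ] φ * fun w ↦ F w - 1 := by
      filter_upwards [eventually_ne_zero_of_order_ne_top hφ.1 hφD.2.1] with z hz
      simp only [hN, diffMonomial, hF, hM, Pi.mul_apply, Pi.inv_apply, Finset.prod_apply,
        Pi.pow_apply, iteratedDeriv_eq_iterate]
      field_simp
    refine ⟨_, ((hS.add hSc).add hSa).add hSφ, fun r hr ↦ ?_⟩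
    have h2 := locallyFinsuppWithin.logCounting_le (nsmul_divisor_sub_le (m := q 0) hφ.1 hφD.2.1
      hFD.1 hFD.2.1 (hFD.sub_one hf h1).2.1 hNF hord) hr
    simp only [map_add, map_sub, map_nsmul, Pi.add_apply, Pi.sub_apply, Pi.smul_apply,
      ← logCounting_zero, ← logCounting_top] at h2 ⊢
    rw [nsmul_eq_mul] at h2
    simp only [reducedCountingPoles, reducedCountingZeros]
    linarith [hSle r hr, hT r]

end Nevanlinna

theorem theorem2p1 (f a φ : ℂ → ℂ) (k : ℕ) (q : ℕ → ℕ)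
    (hf : Nevanlinna.IsTranscendentalMeromorphic f)
    (ha : Nevanlinna.IsSmallFunction f a)
    (hφ : Nevanlinna.IsSmallFunction f φ)
    (hk : 1 ≤ k) (hq0 : 1 ≤ q 0) (hqk : 1 ≤ q k) :
    ∃ S : ℝ → ℝ, Nevanlinna.IsErrorTerm f S ∧ ∀ r : ℝ, 0 < r →
      (Nevanlinna.monomialDegree k q : ℝ) * ValueDistribution.characteristic f ⊤ r ≤
        Nevanlinna.reducedCountingPoles f r
        + ((Nevanlinna.monomialDegree k q : ℝ) - (q 0 : ℝ)) * ValueDistribution.logCounting f 0 r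
        + (1 + (Nevanlinna.monomialWeight k q : ℝ)) * Nevanlinna.reducedCountingZeros f r
        + Nevanlinna.reducedCountingZeros (fun z ↦ Nevanlinna.diffMonomial a k q f z - φ z) r
        + S r := by
  obtain ⟨S, hS, hle⟩ := Nevanlinna.exists_isErrorTerm_le (k := k) (q := q) hf ha hφ
  set A : ℝ → ℝ := fun r ↦ (Nevanlinna.monomialDegree k q : ℝ) * characteristic f ⊤ r with hA
  set B : ℝ → ℝ := fun r ↦ Nevanlinna.reducedCountingPoles f r
        + ((Nevanlinna.monomialDegree k q : ℝ) - (q 0 : ℝ)) * logCounting f 0 r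
        + (1 + (Nevanlinna.monomialWeight k q : ℝ)) * Nevanlinna.reducedCountingZeros f r
        + Nevanlinna.reducedCountingZeros (fun z ↦ Nevanlinna.diffMonomial a k q f z - φ z) r with hB
  -- for `r < 1` counting functions may be negative; taking the excess of the left-hand side over the
  -- right-hand side as error term covers these radii, which play no role as `r → ∞`
  have hS0 : Nevanlinna.IsErrorTerm f fun r ↦ max (S r) 0 := by
    obtain ⟨E, hE0, hE, hSE⟩ := hS
    refine ⟨E, hE0, hE, Asymptotics.IsBigO.trans_isLittleO ?_ hSE⟩
    refine Asymptotics.IsBigO.of_bound 1 (Eventually.of_forall fun r ↦ ?_)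
    rw [one_mul, Real.norm_eq_abs, Real.norm_eq_abs, abs_of_nonneg (le_max_right _ _)]
    exact max_le (le_abs_self _) (abs_nonneg _)
  refine ⟨fun r ↦ max (A r - B r) 0, hS0.of_abs_le' fun r hr ↦ ?_, fun r _ ↦ ?_⟩
  · rw [abs_of_nonneg (le_max_right _ _)]
    refine max_le_max ?_ le_rfl
    have h1 := hle r hr
    have h2 := mul_nonneg (Nat.cast_nonneg (α := ℝ) (Nevanlinna.monomialWeight k q))
      (Nevanlinna.reducedCountingZeros_nonneg f hr)
    simp only [hA, hB]
    linarith
  · have := le_max_left (A r - B r) 0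
    simp only [hA, hB] at this ⊢
    linarith
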